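/- Let $\mathbf{F}_q$ be a finite field with $q$ elements and let $r\ge 1$. For $n\ge 1$ let $L_n^*(\mathbf{F}_q)$ be the poset, ordered by inclusion, of subspaces $U$ of $\mathbf{F}_q^n$ with $0\neq U\neq \mathbf{F}_q^n$, on which $\mathrm{GL}_n(\mathbf{F}_q)$ acts. For a finite poset $P$ let $\tilde\chi(P)$ be the reduced Euler characteristic of its order complex (so $\tilde\chi(\emptyset)=-1$), and for a subgroup $H\le \mathrm{GL}_n(\mathbf{F}_q)$ let $C_{L_n^*(\mathbf{F}_q)}(H)$ be the subposet of $H$-invariant subspaces. For $n\ge 1$ put $$\tilde\chi_r(n,q)=\frac{1}{|\mathrm{GL}_n(\mathbf{F}_q)|}\sum_{X\in \mathrm{Hom}(\mathbf{Z}^r,\mathrm{GL}_n(\mathbf{F}_q))}\tilde\chi\big(C_{L_n^*(\mathbf{F}_q)}(X(\mathbf{Z}^r))\big),$$ and for a prime number $p$ (possibly dividing $q$) let $\tilde\chi^p_r(n,q)$ be defined by the same formula with $\mathbf{Z}^r$ replaced by $\mathbf{Z}\times\mathbf{Z}_p^{r-1}$, where $\mathbf{Z}_p$ is the ring of $p$-adic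 integers. By convention $\tilde\chi_r(0,q)=\tilde\chi^p_r(0,q)=1$. For a positive integer $m$ write $m_p$ for its $p$-part, the largest power of $p$ dividing $m$. Then $$\tilde\chi_r(1,q)=-(q-1)^{r-1},\qquad \tilde\chi_r(n,q)=-\frac1n\sum_{j=1}^{n}(q^j-1)^{r-1}\,\tilde\chi_r(n-j,q)\quad (n\ge 1),$$ and, for every prime $p$, $$\tilde\chi^p_r(1,q)=-\big((q-1)_p\big)^{r-1},\qquad \tilde\chi^p_r(n,q)=-\frac1n\sum_{j=1}^{n}\big((q^j-1)_p\big)^{r-1}\,\tilde\chi^p_r(n-j,q)\quad (n\ge 1).$$ -/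

import Mathlib

open scoped Pointwise

/-- The reduced Euler characteristic of a finite poset `P`, i.e. that of its order complex:
the sum of `(-1) ^ dim` over all chains of `P`, where a chain with `m` elements is a simplex of
dimension `m - 1` and the empty chain has dimension `-1`.  So the empty poset has value `-1`. -/
noncomputable def reducedEulerChar (P : Type*) [PartialOrder P] [Finite P] : ℤ :=
  ∑ s ∈ (Set.toFinite {s : Finset P | IsChain (· ≤ ·) (s : Set P)}).toFinset,
    (-1) ^ (s.card + 1)

/-- For a finite group `G` and a finite `G`-poset `P`, the average
`(1 / |G|) * ∑ X, χ̃ (C_P (X (A)))` over all homomorphisms `X : A → G` of the reduced Euler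
characteristic of the subposet `C_P (X (A))` of elements fixed by the subgroup `X (A)`. -/
noncomputable def equivariantReducedEulerChar (A G P : Type*) [Group A] [Group G] [Finite (A →* G)]
    [PartialOrder P] [Finite P] [MulAction G P] : ℚ :=
  (∑ X ∈ (Set.toFinite (Set.univ : Set (A →* G))).toFinset,
    (reducedEulerChar (MulAction.fixedPoints X.range P) : ℚ)) / (Nat.card G : ℚ)

/-- The `GL(V)`-poset of the nontrivial proper subspaces of `V`, ordered by inclusion;
`g` sends a subspace `U` to its image `g U`. -/
def properSubspaces (K V : Type*) [Field K] [AddCommGroup V] [Module K V] :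
    SubMulAction (LinearMap.GeneralLinearGroup K V) (Submodule K V) where
  carrier := {U | U ≠ ⊥ ∧ U ≠ ⊤}
  smul_mem' g U hU := by
    refine ⟨fun h => hU.1 ?_, fun h => hU.2 ?_⟩
    · rw [eq_bot_iff]
      intro x hx
      have hgx : g • x ∈ g • U := Submodule.smul_mem_pointwise_smul x g U hx
      rw [h, Submodule.mem_bot] at hgx
      exact (Submodule.mem_bot K).2 (smul_left_cancel g (hgx.trans (smul_zero g).symm))
    · rw [eq_top_iff]
      intro x _
      have hx : g • x ∈ g • U := by rw [h]; trivial
      obtain ⟨y, hy, hxy⟩ := Submodule.mem_smul_pointwise_iff_exists _ _ _ |>.1 hx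
      rwa [← smul_left_cancel g hxy]

instance finite_properSubspaces (K V : Type*) [Field K] [AddCommGroup V] [Module K V] [Finite V] :
    Finite (properSubspaces K V) :=
  have : Finite (Submodule K V) := Finite.of_injective _ SetLike.coe_injective
  Subtype.finite

instance finite_generalLinearGroup (K V : Type*) [Field K] [AddCommGroup V] [Module K V]
    [Finite V] : Finite (LinearMap.GeneralLinearGroup K V) :=
  have : Finite (V →ₗ[K] V) := Finite.of_injective _ DFunLike.coe_injective
  inferInstanceAs (Finite (V →ₗ[K] V)ˣ)

/-- A homomorphism from `M ^ k` is determined by its restrictions to the factors. -/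
theorem hom_pi_ext {k : ℕ} {M B : Type*} [AddCommMonoid M] [AddMonoid B]
    (X Y : (Fin k → M) →+ B)
    (h : ∀ i, X.comp (AddMonoidHom.single (fun _ => M) i)
      = Y.comp (AddMonoidHom.single (fun _ => M) i)) : X = Y := by
  ext z
  have hz : z ∈ AddMonoidHom.eqLocusM X Y := by
    rw [← Finset.univ_sum_single z]
    exact sum_mem fun i _ => DFunLike.congr_fun (h i) (z i)
  exact hz

/-- There are finitely many homomorphisms from `ℤ ^ r` to a finite group. -/
instance finite_hom_int_pow (r : ℕ) (G : Type*) [Group G] [Finite G] :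
    Finite (Multiplicative (Fin r → ℤ) →* G) := by
  refine Finite.of_injective
    (fun X (i : Fin r) => X (Multiplicative.ofAdd (Pi.single i (1 : ℤ)))) ?_
  intro X Y h
  have key : MonoidHom.toAdditiveRight X = MonoidHom.toAdditiveRight Y := by
    refine hom_pi_ext _ _ fun i => ?_
    ext
    exact congrArg Additive.ofMul (congrFun h i)
  exact MonoidHom.toAdditiveRight.injective key

/-- A homomorphism from `ℤ_p` to a finite group is determined by its value at `1`. -/
theorem hom_padicInt_ext (p : ℕ) [Fact p.Prime] (G : Type*) [Group G] [Finite G]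
    (X Y : ℤ_[p] →+ Additive G) (h : X 1 = Y 1) : X = Y := by
  ext z
  have hN : ((Nat.card G : ℕ) : ℤ_[p]) ≠ 0 := by exact_mod_cast Nat.card_pos.ne'
  obtain ⟨w, hw⟩ := Ideal.mem_span_singleton'.1
    (PadicInt.appr_spec ((Nat.card G : ℤ_[p]).valuation) z)
  obtain ⟨v, hv⟩ : ∃ v, z = (z.appr ((Nat.card G : ℤ_[p]).valuation)) • (1 : ℤ_[p])
      + Nat.card G • v := by
    refine ⟨w * ((PadicInt.unitCoeff hN)⁻¹ : ℤ_[p]ˣ), ?_⟩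
    have h1 := PadicInt.unitCoeff_spec hN
    have h2 : (p : ℤ_[p]) ^ (Nat.card G : ℤ_[p]).valuation
        = (Nat.card G : ℤ_[p]) * ((PadicInt.unitCoeff hN)⁻¹ : ℤ_[p]ˣ) := by
      rw [Units.eq_mul_inv_iff_mul_eq, mul_comm]
      exact h1.symm
    rw [h2] at hw
    simp only [nsmul_eq_mul, mul_one]
    linear_combination -hw
  have hz : ∀ T : ℤ_[p] →+ Additive G, T (Nat.card G • v) = 0 := fun T => by
    rw [map_nsmul]
    exact pow_card_eq_one' (G := G) (x := (T v).toMul)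
  have hT : ∀ T : ℤ_[p] →+ Additive G,
      T z = (z.appr ((Nat.card G : ℤ_[p]).valuation)) • T 1 := fun T => by
    conv_lhs => rw [hv]
    rw [map_add, hz, add_zero, map_nsmul]
  rw [hT X, hT Y, h]

/-- There are finitely many homomorphisms from `ℤ × ℤ_p ^ k` to a finite group. -/
instance finite_hom_int_prod_padicInt_pow (p : ℕ) [Fact p.Prime] (k : ℕ) (G : Type*) [Group G]
    [Finite G] : Finite (Multiplicative (ℤ × (Fin k → ℤ_[p])) →* G) := by
  refine Finite.of_injective
    (fun X => (X (Multiplicative.ofAdd ((1 : ℤ), (0 : Fin k → ℤ_[p]))),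
      fun i : Fin k => X (Multiplicative.ofAdd ((0 : ℤ), Pi.single i (1 : ℤ_[p]))))) ?_
  intro X Y h
  have key : MonoidHom.toAdditiveRight X = MonoidHom.toAdditiveRight Y := by
    have h1 : (MonoidHom.toAdditiveRight X).comp (AddMonoidHom.inl ℤ (Fin k → ℤ_[p]))
        = (MonoidHom.toAdditiveRight Y).comp (AddMonoidHom.inl ℤ (Fin k → ℤ_[p])) := by
      ext
      exact congrArg Additive.ofMul (congrArg Prod.fst h)
    have h2 : (MonoidHom.toAdditiveRight X).comp (AddMonoidHom.inr ℤ (Fin k → ℤ_[p]))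
        = (MonoidHom.toAdditiveRight Y).comp (AddMonoidHom.inr ℤ (Fin k → ℤ_[p])) := by
      refine hom_pi_ext _ _ fun i => hom_padicInt_ext p G _ _ ?_
      exact congrArg Additive.ofMul (congrFun (congrArg Prod.snd h) i)
    refine AddMonoidHom.ext fun z => ?_
    have e : z = (z.1, 0) + (0, z.2) := by simp
    rw [e, map_add, map_add]
    exact congrArg₂ _ (DFunLike.congr_fun h1 z.1) (DFunLike.congr_fun h2 z.2)
  exact MonoidHom.toAdditiveRight.injective key

/-- The `r`-th equivariant reduced Euler characteristic `χ̃_r(n, q)` of the `GL_n(K)`-poset of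
nontrivial proper subspaces of `K ^ n`, where `K` is the field with `q` elements, for `n ≥ 1`;
it is `1` for `n = 0` by convention. -/
noncomputable def chi (K : Type*) [Field K] [Finite K] (r n : ℕ) : ℚ :=
  if n = 0 then 1 else
    equivariantReducedEulerChar (Multiplicative (Fin r → ℤ))
      (LinearMap.GeneralLinearGroup K (Fin n → K)) (properSubspaces K (Fin n → K))

/-- The `r`-th `p`-primary equivariant reduced Euler characteristic `χ̃^p_r(n, q)`, for `r ≥ 1`:
the same as `chi`, with `ℤ × ℤ_p ^ (r - 1)` in the place of `ℤ ^ r`.  All homomorphisms from this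
group to a finite group are continuous, since a subgroup of index `m` contains the multiples
of `m`. -/
noncomputable def chiPrimary (p : ℕ) [Fact p.Prime] (K : Type*) [Field K] [Finite K] (r n : ℕ) :
    ℚ :=
  if n = 0 then 1 else
    equivariantReducedEulerChar (Multiplicative (ℤ × (Fin (r - 1) → ℤ_[p])))
      (LinearMap.GeneralLinearGroup K (Fin n → K)) (properSubspaces K (Fin n → K))

/-- The `p`-part `m_p = p ^ ν_p(m)` of the positive integer `m`. -/
def pPart (p m : ℕ) : ℕ := p ^ padicValNat p m

/-! Write the source group as `ℤ × B`, with `B = ℤ^(r-1)` or `ℤ_p^(r-1)`, and let `K` be the field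
with `q` elements. A homomorphism to `GL(V)` is a homomorphism `Y` from `B`, which makes `V` a
module over the commutative ring `K[B]`, together with an automorphism `g` of that module. The fixed
subspaces are the submodules `U` with `gU = U`, and for `V ≠ 0` the reduced Euler characteristic is
the Möbius number of their lattice.

The average of this number over `g` depends only on the isomorphism class of the module. It vanishes
unless the module is semisimple, because the socle is invariant and meets every nonzero submodule
(`fixedMobius_eq_zero`). A finite semisimple module is given by a multiset `t` of maximal ideals.
Averaging the defining recursion of the Möbius function shows that the averages over the
submultisets of a nonempty `t` sum to zero. So the average is `(-1)^|t|` if `t` has no repetition,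
and `0` otherwise (`meanMobius_eq_squarefreeSign`).

By orbit counting each isomorphism class contributes its average once, so the Euler characteristic
is the sum of `(-1)^|s|` over sets `s` of maximal ideals of total degree `n`
(`sum_card_centralizer_mul_meanMobius`). This is the coefficient of `x^n` in the product of the
factors `1 - x^(deg m)`. The logarithmic derivative gives a recursion with coefficients `∑ deg m`
over the `m` with `deg m ∣ j` (`mul_sum_signed_subsets`). That sum counts algebra maps from `K[B]`
to the extension `L` of degree `j`, that is, homomorphisms `B → Lˣ` (`natCard_monoidHom_units`).
Since `Lˣ` is cyclic of order `q^j - 1`, their number is `(q^j - 1)^(r-1)`, respectively the same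
power of its `p`-part. -/

/-! ### Möbius numbers of finite posets -/

section PosetEuler

-- Turning chains of a subposet into finsets of the ambient type lets chains of different intervals
-- be compared.
open Classical in
theorem reducedEulerChar_subtype {L : Type*} [PartialOrder L] [Fintype L] (p : L → Prop) :
    reducedEulerChar {x // p x} =
      ∑ s ∈ Finset.univ.filter
        (fun s : Finset L => IsChain (· ≤ ·) (s : Set L) ∧ ∀ x ∈ s, p x), (-1) ^ (s.card + 1) := by
  unfold reducedEulerChar
  refine Finset.sum_bij' (fun s _ => s.map (Function.Embedding.subtype p))
    (fun s _ => s.subtype p) ?_ ?_ ?_ ?_ ?_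
  · intro s hs
    simp only [Set.Finite.mem_toFinset, Set.mem_ofPred_eq] at hs
    simp only [Finset.mem_filter, Finset.mem_univ, true_and]
    refine ⟨?_, fun x hx => ?_⟩
    · rw [Finset.coe_map]
      rintro _ ⟨x, hx, rfl⟩ _ ⟨y, hy, rfl⟩ hxy
      exact hs hx hy (fun h => hxy (by rw [h]))
    · exact Finset.property_of_mem_map_subtype s hx
  · intro s hs
    simp only [Finset.mem_filter, Finset.mem_univ, true_and] at hs
    simp only [Set.Finite.mem_toFinset, Set.mem_ofPred_eq]
    intro x hx y hy hxy
    simp only [Finset.mem_coe, Finset.mem_subtype] at hx hy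
    exact hs.1 hx hy (fun h => hxy (Subtype.ext h))
  · intro s _
    ext x
    simpa using fun _ => x.2
  · intro s hs
    simp only [Finset.mem_filter, Finset.mem_univ, true_and] at hs
    exact Finset.subtype_map_of_mem hs.2
  · intro s _
    simp

theorem reducedEulerChar_congr {P Q : Type*} [PartialOrder P] [Finite P] [PartialOrder Q]
    [Finite Q] (e : P ≃o Q) : reducedEulerChar P = reducedEulerChar Q := by
  unfold reducedEulerChar
  refine Finset.sum_equiv e.toEquiv.finsetCongr ?_ ?_
  · intro s
    simp only [Set.Finite.mem_toFinset, Set.mem_ofPred_eq, Equiv.finsetCongr_apply,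
      Finset.coe_map]
    constructor
    · rintro hs _ ⟨x, hx, rfl⟩ _ ⟨y, hy, rfl⟩ hxy
      simpa using hs hx hy (fun h => hxy (by rw [h]))
    · intro hs x hx y hy hxy
      simpa using hs (Set.mem_image_of_mem _ hx) (Set.mem_image_of_mem _ hy)
        (fun h => hxy (e.injective h))
  · intro s _
    simp

/-- The Möbius function `μ(⊥, u)` of a finite poset, as a reduced Euler characteristic. -/
noncomputable def bottomMobius {L : Type*} [PartialOrder L] [OrderBot L] [Finite L] (u : L) : ℤ :=
  open Classical in if u = ⊥ then 1 else reducedEulerChar {x : L // ⊥ < x ∧ x < u}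

-- A nonempty chain in the open interval `(⊥, u)` is its maximum `v` together with a chain in `(⊥,
-- v)`. Removing `v` flips the sign, so the nonempty chains contribute minus the sum over `⊥ < v <
-- u`; the empty chain contributes `-1`, which cancels the term of `⊥`.
open Classical in
theorem sum_bottomMobius {L : Type*} [PartialOrder L] [OrderBot L] [Fintype L] {u : L}
    (hu : u ≠ ⊥) : ∑ v ∈ Finset.univ.filter (fun v : L => v ≤ u), bottomMobius v = 0 := by
  set C : L → Finset (Finset L) := fun v => Finset.univ.filter
    (fun s => IsChain (· ≤ ·) (s : Set L) ∧ ∀ x ∈ s, ⊥ < x ∧ x < v) with hC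
  have memC : ∀ v s, s ∈ C v ↔ IsChain (· ≤ ·) (s : Set L) ∧ ∀ x ∈ s, ⊥ < x ∧ x < v := by
    intro v s; simp [hC]
  have hmu : ∀ v : L, v ≠ ⊥ → bottomMobius v = ∑ s ∈ C v, (-1) ^ (s.card + 1) := by
    intro v hv
    rw [bottomMobius, if_neg hv, reducedEulerChar_subtype]
    exact Finset.sum_congr (by ext; simp [hC]) fun _ _ => rfl
  have hempty : ∅ ∈ C u := by simp [memC]
  have hsplit : Finset.univ.filter (fun v : L => v ≤ u) =
      insert u (insert ⊥ (Finset.univ.filter (fun v : L => ⊥ < v ∧ v < u))) := by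
    ext v
    simp only [Finset.mem_filter, Finset.mem_univ, true_and, Finset.mem_insert]
    constructor
    · intro h
      by_cases h1 : v = u
      · exact Or.inl h1
      by_cases h2 : v = ⊥
      · exact Or.inr (Or.inl h2)
      exact Or.inr (Or.inr ⟨bot_lt_iff_ne_bot.2 h2, lt_of_le_of_ne h h1⟩)
    · rintro (h | h | h)
      · exact h.le
      · rw [h]; exact bot_le
      · exact h.2.le
  have hsum : ∑ s ∈ (C u).erase ∅, (-1 : ℤ) ^ (s.card + 1) =
      -∑ v ∈ Finset.univ.filter (fun v : L => ⊥ < v ∧ v < u), bottomMobius v := by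
    have h1 : ∀ v ∈ Finset.univ.filter (fun v : L => ⊥ < v ∧ v < u),
        bottomMobius v = ∑ s ∈ C v, (-1) ^ (s.card + 1) := by
      intro v hv
      simp only [Finset.mem_filter, Finset.mem_univ, true_and] at hv
      exact hmu v hv.1.ne'
    rw [Finset.sum_congr rfl h1, Finset.sum_sigma', ← Finset.sum_neg_distrib]
    symm
    have hnot : ∀ v s, s ∈ C v → v ∉ s := fun v s hs hv => (((memC v s).1 hs).2 v hv).2.false
    refine Finset.sum_bij (fun x _ => insert x.1 x.2) ?_ ?_ ?_ ?_
    · rintro ⟨v, s⟩ hx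
      simp only [Finset.mem_sigma, Finset.mem_filter, Finset.mem_univ, true_and, memC] at hx
      obtain ⟨hv, hs, hs'⟩ := hx
      simp only [Finset.mem_erase, memC]
      refine ⟨Finset.insert_ne_empty _ _, ?_, ?_⟩
      · rw [Finset.coe_insert]
        exact hs.insert fun b hb _ => Or.inr (hs' b hb).2.le
      · intro x hx
        rcases Finset.mem_insert.1 hx with rfl | hx
        · exact hv
        · exact ⟨(hs' x hx).1, (hs' x hx).2.trans hv.2⟩
    · rintro ⟨v, s⟩ hx ⟨w, t⟩ hy h
      simp only [Finset.mem_sigma] at hx hy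
      have hs := ((memC v s).1 hx.2).2
      have ht := ((memC w t).1 hy.2).2
      simp only at h
      have hvw : v = w := by
        have h1 : v ∈ insert w t := h ▸ Finset.mem_insert_self v s
        have h2 : w ∈ insert v s := h ▸ Finset.mem_insert_self w t
        rcases Finset.mem_insert.1 h1 with h1 | h1
        · exact h1
        rcases Finset.mem_insert.1 h2 with h2 | h2
        · exact h2.symm
        exact absurd ((hs w h2).2.trans (ht v h1).2) (lt_irrefl w)
      subst hvw
      have : s = t := by
        rw [← Finset.erase_insert (hnot v s hx.2), h, Finset.erase_insert (hnot v t hy.2)]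
      rw [this]
    · intro s hs
      obtain ⟨hne, hs⟩ := Finset.mem_erase.1 hs
      obtain ⟨hch, hb⟩ := (memC u s).1 hs
      obtain ⟨v, hv, hmax⟩ := s.exists_maximal (Finset.nonempty_iff_ne_empty.2 hne)
      refine ⟨⟨v, s.erase v⟩, ?_, Finset.insert_erase hv⟩
      simp only [Finset.mem_sigma, Finset.mem_filter, Finset.mem_univ, true_and, memC]
      refine ⟨hb v hv, hch.mono (by simp), fun x hx => ?_⟩
      obtain ⟨hxv, hx⟩ := Finset.mem_erase.1 hx
      refine ⟨(hb x hx).1, lt_of_le_of_ne ?_ hxv⟩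
      rcases hch hx hv hxv with h | h
      · exact h
      · exact hmax hx h
    · rintro ⟨v, s⟩ hx
      simp only [Finset.mem_sigma] at hx
      rw [Finset.card_insert_of_notMem (hnot v s hx.2)]
      ring
  rw [hsplit, Finset.sum_insert, Finset.sum_insert, hmu u hu, ← Finset.add_sum_erase _ _ hempty,
    hsum]
  · rw [bottomMobius, if_pos rfl, Finset.card_empty]; ring
  · simp
  · simp [hu]

open Classical in
/-- If every nonzero element of a finite poset has a nonzero meet with `s`, then `μ(⊥, u)` vanishes
for all `u` not below `s`. -/
theorem bottomMobius_eq_zero {L : Type*} [PartialOrder L] [OrderBot L] [Fintype L] (s : L)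
    (hs : ∀ u : L, u ≠ ⊥ → ∃ w, w ≠ ⊥ ∧ ∀ v, v ≤ w ↔ v ≤ u ∧ v ≤ s) (u : L) (hu : ¬ u ≤ s) :
    bottomMobius u = 0 := by
  induction u using WellFoundedLT.induction with
  | ind u ih =>
    have hu0 : u ≠ ⊥ := fun h => hu (h ▸ bot_le)
    obtain ⟨w, hw, hw'⟩ := hs u hu0
    have h1 := sum_bottomMobius hu0
    -- The terms with `v ≤ s` are those with `v ≤ w`, where `w ≠ ⊥` is the meet of `u` and `s`, so
    -- they sum to zero. Among the others all but `v = u` vanish by induction.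
    rw [← Finset.sum_filter_add_sum_filter_not _ (fun v => v ≤ s), Finset.filter_filter,
      Finset.filter_filter] at h1
    simp only [← hw'] at h1
    rw [sum_bottomMobius hw, zero_add, Finset.sum_eq_single u] at h1
    · exact h1
    · intro v hv hvu
      simp only [Finset.mem_filter, Finset.mem_univ, true_and] at hv
      exact ih v (lt_of_le_of_ne hv.1 hvu) hv.2
    · simp [hu]

end PosetEuler

section BottomMobius

theorem bottomMobius_of_isBot {L : Type*} [PartialOrder L] [OrderBot L] [Finite L] {u : L}
    (hu : u = ⊥) : bottomMobius u = 1 := by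
  rw [bottomMobius, if_pos hu]

theorem bottomMobius_top_eq {L : Type*} [PartialOrder L] [BoundedOrder L] [Finite L]
    [Nontrivial L] {P : Type*} [PartialOrder P] [Finite P] (e : {x : L // ⊥ < x ∧ x < ⊤} ≃o P) :
    bottomMobius (⊤ : L) = reducedEulerChar P := by
  rw [bottomMobius, if_neg top_ne_bot, reducedEulerChar_congr e]

theorem bottomMobius_congr {L L' : Type*} [PartialOrder L] [OrderBot L] [Finite L]
    [PartialOrder L'] [BoundedOrder L'] [Finite L'] (u : L) (e : Set.Iic u ≃o L') :
    bottomMobius u = bottomMobius (⊤ : L') := by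
  have hbot : e ⊥ = ⊥ := map_bot e
  have htop : e ⊤ = ⊤ := map_top e
  by_cases hu : u = ⊥
  · rw [bottomMobius_of_isBot hu, bottomMobius_of_isBot]
    rw [← htop, ← hbot]
    exact congrArg e (Subtype.ext hu)
  · have : (⊤ : L') ≠ ⊥ := by
      rw [← htop, ← hbot]
      exact fun h => hu (congrArg Subtype.val (e.injective h))
    rw [bottomMobius, bottomMobius, if_neg hu, if_neg this]
    have h1 : ∀ x : Set.Iic u, ⊥ < e x ↔ ⊥ < x.1 := fun x => by
      rw [← hbot, e.lt_iff_lt]; rfl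
    have h2 : ∀ x : Set.Iic u, e x < ⊤ ↔ x.1 < u := fun x => by
      rw [← htop, e.lt_iff_lt]; rfl
    refine reducedEulerChar_congr
      { toFun := fun x => ⟨e ⟨x.1, x.2.2.le⟩, (h1 _).2 x.2.1, (h2 _).2 x.2.2⟩
        invFun := fun y => ⟨(e.symm y.1).1, (h1 _).1 (by simpa using y.2.1),
          (h2 _).1 (by simpa using y.2.2)⟩
        left_inv := fun x => by simp
        right_inv := fun y => Subtype.ext (e.apply_symm_apply y.1)
        map_rel_iff' := ?_ }
    intro a b
    simp [← Subtype.coe_le_coe]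

end BottomMobius

/-! ### Submodules fixed by an automorphism, and averages over automorphisms -/

section FixedSubmodules

variable {R V : Type*} [CommRing R] [AddCommGroup V] [Module R V]

instance finite_linearEquiv [Finite V] : Finite (V ≃ₗ[R] V) :=
  Finite.of_injective _ DFunLike.coe_injective

/-- The poset of submodules mapped onto themselves by the automorphism `g`. -/
abbrev FixedSubmodules (g : V ≃ₗ[R] V) : Type _ := {U : Submodule R V // g • U = U}

theorem LinearEquiv.smul_top_submodule (g : V ≃ₗ[R] V) : g • (⊤ : Submodule R V) = ⊤ := by
  rw [eq_top_iff]
  intro x _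
  exact (Submodule.mem_smul_pointwise_iff_exists _ _ _).2 ⟨g.symm x, trivial, by simp⟩

instance (g : V ≃ₗ[R] V) : BoundedOrder (FixedSubmodules g) where
  top := ⟨⊤, g.smul_top_submodule⟩
  le_top x := le_top (a := x.1)
  bot := ⟨⊥, Submodule.smul_bot' g⟩
  bot_le x := bot_le (a := x.1)

/-- The Möbius number of the poset of submodules fixed by `g`. -/
noncomputable def fixedMobius [Finite V] (g : V ≃ₗ[R] V) : ℤ :=
  bottomMobius (⊤ : FixedSubmodules g)

theorem LinearEquiv.map_eq_of_mem_stabilizer {U : Submodule R V} {g : V ≃ₗ[R] V}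
    (hg : g • U = U) : U.map (g : V →ₗ[R] V) = U := hg

/-- The restriction of the automorphisms preserving `U` to `U`. -/
def stabilizerRestrict (U : Submodule R V) :
    MulAction.stabilizer (V ≃ₗ[R] V) U →* (U ≃ₗ[R] U) where
  toFun g := g.1.ofSubmodules U U (LinearEquiv.map_eq_of_mem_stabilizer g.2)
  map_one' := by ext; simp
  map_mul' g h := by ext; simp

theorem mem_smul_submodule_iff (g : V ≃ₗ[R] V) (U : Submodule R V) (x : V) :
    x ∈ g • U ↔ ∃ y ∈ U, g y = x :=
  Submodule.mem_smul_pointwise_iff_exists _ _ _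

theorem smul_map_subtype_eq_iff {U : Submodule R V} (g : MulAction.stabilizer (V ≃ₗ[R] V) U)
    (W : Submodule R U) :
    g.1 • W.map U.subtype = W.map U.subtype ↔ stabilizerRestrict U g • W = W := by
  have h : g.1 • W.map U.subtype = (stabilizerRestrict U g • W).map U.subtype := by
    ext x
    simp only [mem_smul_submodule_iff, Submodule.mem_map]
    constructor
    · rintro ⟨_, ⟨y, hy, rfl⟩, rfl⟩
      exact ⟨_, ⟨y, hy, rfl⟩, rfl⟩
    · rintro ⟨_, ⟨y, hy, rfl⟩, rfl⟩
      exact ⟨_, ⟨y, hy, rfl⟩, rfl⟩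
  rw [h, (Submodule.map_injective_of_injective U.injective_subtype).eq_iff]

/-- The fixed submodules below `U` form the lattice belonging to the restriction of `g` to `U`, so
the Möbius recursion for `V` involves only Möbius numbers of the same kind for smaller modules. -/
theorem bottomMobius_fixedSubmodules [Finite V] (g : V ≃ₗ[R] V) (U : FixedSubmodules g) :
    bottomMobius U = fixedMobius (stabilizerRestrict U.1 ⟨g, U.2⟩) := by
  refine bottomMobius_congr U (OrderIso.symm ?_)
  exact
    { toFun := fun W => ⟨⟨W.1.map U.1.subtype,
        (smul_map_subtype_eq_iff (⟨g, U.2⟩ : MulAction.stabilizer (V ≃ₗ[R] V) U.1) W.1).2 W.2⟩,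
        Submodule.map_subtype_le _ _⟩
      invFun := fun W => ⟨W.1.1.comap U.1.subtype,
        (smul_map_subtype_eq_iff (⟨g, U.2⟩ : MulAction.stabilizer (V ≃ₗ[R] V) U.1) _).1 (by
          have hW : W.1.1 ≤ U.1 := W.2
          rw [Submodule.map_comap_subtype, inf_eq_right.2 hW]
          exact W.1.2)⟩
      left_inv := fun W => Subtype.ext
        (Submodule.comap_map_eq_of_injective U.1.injective_subtype _)
      right_inv := fun W => by
        have hW : W.1.1 ≤ U.1 := W.2
        refine Subtype.ext (Subtype.ext ?_)
        simp only [Submodule.map_comap_subtype, inf_eq_right.2 hW]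
      map_rel_iff' := fun {a b} =>
        (Submodule.map_le_map_iff_of_injective U.1.injective_subtype a.1 b.1) }

theorem fixedMobius_of_subsingleton [Finite V] [Subsingleton V] (g : V ≃ₗ[R] V) :
    fixedMobius g = 1 :=
  bottomMobius_of_isBot (Subtype.ext (Subsingleton.elim _ _))

/-- The socle `S` is carried to itself by every automorphism. It meets each nonzero submodule, since
by finiteness such a submodule contains a simple one, and it is not all of `V`. Hence
`bottomMobius_eq_zero` applies with `s = S` and `u = ⊤`. -/
theorem fixedMobius_eq_zero [Finite V] (h : ¬ IsSemisimpleModule R V) (g : V ≃ₗ[R] V) :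
    fixedMobius g = 0 := by
  classical
  have := Fintype.ofFinite (FixedSubmodules g)
  set S : Submodule R V := sSup {m : Submodule R V | IsSimpleModule R m} with hS
  have hle : ∀ g : V ≃ₗ[R] V, g • S ≤ S := by
    intro g
    rw [hS, sSup_eq_iSup', Submodule.smul_iSup']
    refine iSup_le fun m => le_iSup_of_le ⟨g • m.1, ?_⟩ le_rfl
    have : IsSimpleModule R m.1 := m.2
    exact IsSimpleModule.congr (g.submoduleMap m.1).symm
  have hgS : g • S = S := le_antisymm (hle g) (by
    calc S = g • g⁻¹ • S := (smul_inv_smul g S).symm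
      _ ≤ g • S := smul_mono_right g (hle g⁻¹))
  refine bottomMobius_eq_zero ⟨S, hgS⟩ ?_ ⊤ ?_
  · intro U hU
    have hU' : U.1 ≠ ⊥ := fun h => hU (Subtype.ext h)
    refine ⟨⟨U.1 ⊓ S, ?_⟩, fun h => ?_, fun v => ?_⟩
    · have : g • (U.1 ⊓ S) = g • U.1 ⊓ g • S := Submodule.map_inf _ g.injective
      rw [this, U.2, hgS]
    · obtain ⟨a, ha, haU⟩ := (eq_bot_or_exists_atom_le U.1).resolve_left hU'
      have haS : a ≤ S := le_sSup (isSimpleModule_iff_isAtom.2 ha)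
      have hbot : U.1 ⊓ S = ⊥ := congrArg Subtype.val h
      exact ha.1 (le_bot_iff.1 (hbot ▸ le_inf haU haS))
    · exact (le_inf_iff : v.1 ≤ U.1 ⊓ S ↔ _)
  · intro hle
    refine h (IsSemisimpleModule.of_sSup_simples_eq_top (eq_top_iff.2 ?_))
    exact hle

/-- By semisimplicity `U` has a complement, and an automorphism of `U` extends by the identity on
it. -/
theorem stabilizerRestrict_surjective [IsSemisimpleModule R V] (U : Submodule R V) :
    Function.Surjective (stabilizerRestrict U) := by
  intro u
  obtain ⟨W, hW⟩ := exists_isCompl U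
  set φ : V ≃ₗ[R] V := (U.prodEquivOfIsCompl W hW).symm ≪≫ₗ
    (u.prodCongr (LinearEquiv.refl R W)) ≪≫ₗ U.prodEquivOfIsCompl W hW with hφ
  have h : ∀ x : U, φ x = u x := by
    intro x
    simp [hφ]
  have hU : φ • U = U := by
    ext x
    rw [mem_smul_submodule_iff]
    constructor
    · rintro ⟨y, hy, rfl⟩
      rw [h ⟨y, hy⟩]
      exact (u _).2
    · intro hx
      exact ⟨u.symm ⟨x, hx⟩, (u.symm _).2, by rw [h]; simp⟩
  exact ⟨⟨φ, hU⟩, LinearEquiv.ext fun x => Subtype.ext (h x)⟩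

/-- The average of the Möbius numbers of the fixed submodule posets over all automorphisms. -/
noncomputable def meanMobius (R V : Type*) [CommRing R] [AddCommGroup V] [Module R V] [Finite V] :
    ℚ :=
  (∑ᶠ g : V ≃ₗ[R] V, (fixedMobius g : ℚ)) / Nat.card (V ≃ₗ[R] V)

theorem meanMobius_eq_zero [Finite V] (h : ¬ IsSemisimpleModule R V) : meanMobius R V = 0 := by
  simp [meanMobius, fixedMobius_eq_zero h]

theorem meanMobius_of_subsingleton [Finite V] [Subsingleton V] : meanMobius R V = 1 := by
  have := Fintype.ofFinite (V ≃ₗ[R] V)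
  simp [meanMobius, fixedMobius_of_subsingleton, finsum_eq_sum_of_fintype]

theorem sum_comp_of_surjective {G H : Type*} [Group G] [Group H] [Fintype G] [Fintype H]
    (φ : G →* H) (hφ : Function.Surjective φ) (f : H → ℚ) :
    ∑ g, f (φ g) = Nat.card G * ((∑ h, f h) / Nat.card H) := by
  classical
  set c := (Finset.univ.filter fun g => φ g = 1).card with hc
  have hfib : ∀ h, (Finset.univ.filter fun g => φ g = h).card = c := fun h =>
    MonoidHom.card_fiber_eq_of_mem_range φ (hφ h) (hφ 1)
  have key : ∀ F : H → ℚ, ∑ g, F (φ g) = c * ∑ h, F h := by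
    intro F
    rw [← Finset.sum_fiberwise (s := Finset.univ) (g := φ), Finset.mul_sum]
    refine Finset.sum_congr rfl fun h _ => ?_
    rw [Finset.sum_congr rfl (g := fun _ => F h), Finset.sum_const, hfib, nsmul_eq_mul]
    intro g hg
    rw [(Finset.mem_filter.1 hg).2]
  have h1 := key fun _ => 1
  simp only [Finset.sum_const, Finset.card_univ, nsmul_eq_mul, mul_one] at h1
  rw [key, Nat.card_eq_fintype_card, Nat.card_eq_fintype_card, h1]
  have : (Fintype.card H : ℚ) ≠ 0 := by exact_mod_cast Fintype.card_ne_zero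
  field_simp

/-- Sum the Möbius number of `g` restricted to `U` over all pairs with `gU = U`. For fixed `g` the
sum is zero by the Möbius recursion. For fixed `U` the restrictions run uniformly over the
automorphisms of `U`, by surjectivity of restriction, which gives the average for `U` times the
order of the stabilizer. -/
theorem sum_card_stabilizer_mul_meanMobius [Finite V] [Nontrivial V] [IsSemisimpleModule R V]
    [Fintype (Submodule R V)] :
    ∑ U : Submodule R V, (Nat.card (MulAction.stabilizer (V ≃ₗ[R] V) U) : ℚ) * meanMobius R U
      = 0 := by
  classical
  have := Fintype.ofFinite (V ≃ₗ[R] V)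
  have hfix : ∀ g : V ≃ₗ[R] V, ∑ U : FixedSubmodules g,
      (fixedMobius (stabilizerRestrict U.1 ⟨g, U.2⟩) : ℚ) = 0 := by
    intro g
    have h := sum_bottomMobius (L := FixedSubmodules g) (u := ⊤)
      (fun h => top_ne_bot (α := Submodule R V) (congrArg Subtype.val h))
    simp only [le_top, Finset.filter_true] at h
    rw [← Int.cast_sum, ← Int.cast_zero (R := ℚ), ← h]
    simp only [bottomMobius_fixedSubmodules]
  have hstab : ∀ U : Submodule R V,
      (Nat.card (MulAction.stabilizer (V ≃ₗ[R] V) U) : ℚ) * meanMobius R U =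
      ∑ g : MulAction.stabilizer (V ≃ₗ[R] V) U, (fixedMobius (stabilizerRestrict U g) : ℚ) := by
    intro U
    have := Fintype.ofFinite (U ≃ₗ[R] U)
    rw [sum_comp_of_surjective (stabilizerRestrict U) (stabilizerRestrict_surjective U)
      (fun g => (fixedMobius g : ℚ)), meanMobius, finsum_eq_sum_of_fintype]
  rw [Finset.sum_congr rfl fun U _ => hstab U, ← Fintype.sum_sigma',
    ← Finset.sum_const_zero (s := (Finset.univ : Finset (V ≃ₗ[R] V))),
    ← Finset.sum_congr rfl fun g _ => hfix g, ← Fintype.sum_sigma']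
  exact Fintype.sum_equiv
    { toFun := fun x => ⟨x.2.1, ⟨x.1, x.2.2⟩⟩
      invFun := fun x => ⟨x.2.1, ⟨x.1, x.2.2⟩⟩
      left_inv := fun _ => rfl
      right_inv := fun _ => rfl } _ _ (by rintro ⟨U, g, hg⟩; rfl)

end FixedSubmodules

/-! ### Finite semisimple modules as multisets of maximal ideals -/

section ModuleTypes

open Classical in
/-- The direct sum of the residue fields of a multiset of maximal ideals. -/
abbrev ResidueModule {R : Type*} [CommRing R] (t : Multiset (MaximalSpectrum R)) : Type _ :=
  (i : t) → R ⧸ i.1.asIdeal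

/-- `V` is isomorphic to the direct sum of the residue fields of the multiset `t` of maximal
ideals. -/
def HasResidueType (R V : Type*) [CommRing R] [AddCommGroup V] [Module R V]
    (t : Multiset (MaximalSpectrum R)) : Prop :=
  Nonempty (V ≃ₗ[R] ResidueModule t)

theorem exists_equiv_of_map_univ_eq {ι κ α : Type*} [Fintype ι] [Fintype κ] {f : ι → α}
    {g : κ → α} (h : Finset.univ.val.map f = Finset.univ.val.map g) :
    ∃ e : ι ≃ κ, ∀ i, g (e i) = f i := by
  classical
  have hc : ∀ a, Nonempty ({i // f i = a} ≃ {k // g k = a}) := by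
    intro a
    refine ⟨Fintype.equivOfCardEq ?_⟩
    have := congrArg (Multiset.count a) h
    simp only [Multiset.count_map] at this
    rw [Fintype.card_subtype, Fintype.card_subtype]
    simp only [eq_comm (a := a)] at this
    exact this
  exact ⟨Equiv.ofFiberEquiv fun a => (hc a).some, Equiv.ofFiberEquiv_map _⟩

variable {R : Type*} [CommRing R]

theorem nonempty_piResidue_equiv {ι κ : Type*} [Fintype ι] [Fintype κ]
    {f : ι → MaximalSpectrum R} {g : κ → MaximalSpectrum R}
    (h : Finset.univ.val.map f = Finset.univ.val.map g) :
    Nonempty (((i : ι) → R ⧸ (f i).asIdeal) ≃ₗ[R] ((k : κ) → R ⧸ (g k).asIdeal)) := by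
  obtain ⟨e, he⟩ := exists_equiv_of_map_univ_eq h
  obtain rfl : (fun i => g (e i)) = f := funext he
  exact ⟨LinearEquiv.piCongrLeft R (fun k => R ⧸ (g k).asIdeal) e⟩

theorem hasResidueType_pi {ι : Type*} [Fintype ι] (f : ι → MaximalSpectrum R) :
    HasResidueType R ((i : ι) → R ⧸ (f i).asIdeal) (Finset.univ.val.map f) := by
  classical
  exact nonempty_piResidue_equiv (Multiset.map_univ_coe _).symm

variable {V W : Type*} [AddCommGroup V] [Module R V] [AddCommGroup W] [Module R W]
  {s t : Multiset (MaximalSpectrum R)}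

theorem HasResidueType.congr (h : HasResidueType R V t) (e : W ≃ₗ[R] V) : HasResidueType R W t :=
  ⟨e ≪≫ₗ h.some⟩

theorem HasResidueType.nonempty_equiv (h : HasResidueType R V t) (h' : HasResidueType R W t) :
    Nonempty (V ≃ₗ[R] W) :=
  ⟨h.some ≪≫ₗ h'.some.symm⟩

theorem hasResidueType_residueModule (t : Multiset (MaximalSpectrum R)) :
    HasResidueType R (ResidueModule t) t :=
  ⟨LinearEquiv.refl _ _⟩

theorem HasResidueType.prod (h : HasResidueType R V s) (h' : HasResidueType R W t) :
    HasResidueType R (V × W) (s + t) := by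
  classical
  let f : (s : Type _) ⊕ (t : Type _) → MaximalSpectrum R := Sum.elim (fun i => i.1) (fun i => i.1)
  have hf : Finset.univ.val.map f = s + t := by
    rw [← Finset.univ_disjSum_univ, Finset.val_disjSum, Multiset.disjSum, Multiset.map_add,
      Multiset.map_map, Multiset.map_map]
    exact congrArg₂ _ (Multiset.map_univ_coe s) (Multiset.map_univ_coe t)
  have h1 := hasResidueType_pi f
  rw [hf] at h1
  exact h1.congr ((h.some.prodCongr h'.some) ≪≫ₗ
    (LinearEquiv.sumPiEquivProdPi R _ _ fun i => R ⧸ (f i).asIdeal).symm)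

theorem HasResidueType.isSemisimpleModule (h : HasResidueType R V t) : IsSemisimpleModule R V := by
  classical
  have : ∀ m : MaximalSpectrum R, IsSimpleModule R (R ⧸ m.asIdeal) := fun m =>
    isSimpleModule_iff_quot_maximal.2 ⟨m.asIdeal, m.isMaximal, ⟨LinearEquiv.refl _ _⟩⟩
  exact IsSemisimpleModule.congr h.some

theorem exists_hasResidueType [IsSemisimpleModule R V] [Finite V] :
    ∃ t, HasResidueType R V t := by
  classical
  obtain ⟨n, S, e, hS⟩ := IsSemisimpleModule.exists_linearEquiv_fin_dfinsupp R V
  have h1 : ∀ i, ∃ m : MaximalSpectrum R, Nonempty (S i ≃ₗ[R] R ⧸ m.asIdeal) := fun i => by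
    obtain ⟨I, hI, ⟨φ⟩⟩ := isSimpleModule_iff_quot_maximal.1 (hS i)
    exact ⟨⟨I, hI⟩, ⟨φ⟩⟩
  choose f hf using h1
  exact ⟨_, (hasResidueType_pi f).congr (e ≪≫ₗ DFinsupp.linearEquivFunOnFintype ≪≫ₗ
    LinearEquiv.piCongrRight fun i => (hf i).some)⟩

theorem natCard_torsion_quotient (m n : MaximalSpectrum R) [Decidable (n = m)] :
    Nat.card {x : R ⧸ n.asIdeal // ∀ r ∈ m.asIdeal, r • x = 0} =
      if n = m then Nat.card (R ⧸ m.asIdeal) else 1 := by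
  split_ifs with h
  · subst h
    refine Nat.card_congr (Equiv.subtypeUnivEquiv fun x r hr => ?_)
    obtain ⟨y, rfl⟩ := Ideal.Quotient.mk_surjective x
    rw [← Ideal.Quotient.mk_eq_mk, ← Submodule.Quotient.mk_smul, Submodule.Quotient.mk_eq_zero]
    exact Ideal.mul_mem_right _ _ hr
  · have hle : ¬ m.asIdeal ≤ n.asIdeal := fun hle =>
      h (MaximalSpectrum.ext (m.isMaximal.eq_of_le n.isMaximal.ne_top hle).symm)
    obtain ⟨r, hr, hrn⟩ := SetLike.not_le_iff_exists.1 hle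
    rw [Nat.card_eq_one_iff_unique]
    refine ⟨⟨fun x y => Subtype.ext ?_⟩, ⟨⟨0, fun r _ => smul_zero r⟩⟩⟩
    have key : ∀ x : R ⧸ n.asIdeal, r • x = 0 → x = 0 := by
      intro x hx
      obtain ⟨y, rfl⟩ := Ideal.Quotient.mk_surjective x
      rw [← Ideal.Quotient.mk_eq_mk, ← Submodule.Quotient.mk_smul,
        Submodule.Quotient.mk_eq_zero] at hx
      rw [Ideal.Quotient.eq_zero_iff_mem]
      exact (n.isMaximal.isPrime.mem_or_mem hx).resolve_left hrn
    rw [key x.1 (x.2 r hr), key y.1 (y.2 r hr)]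

-- The multiplicity of `m` can be read off from the number of elements killed by `m`; this is what
-- makes the type of a finite module unique.
open Classical in
theorem HasResidueType.natCard_torsion (h : HasResidueType R V t) (m : MaximalSpectrum R) :
    Nat.card {x : V // ∀ r ∈ m.asIdeal, r • x = 0} =
      Nat.card (R ⧸ m.asIdeal) ^ t.count m := by
  obtain ⟨e⟩ := h
  have e1 : {x : V // ∀ r ∈ m.asIdeal, r • x = 0} ≃
      ((i : t) → {x : R ⧸ i.1.asIdeal // ∀ r ∈ m.asIdeal, r • x = 0}) :=
    (e.toEquiv.subtypeEquiv (q := fun y => ∀ i, ∀ r ∈ m.asIdeal, r • y i = 0) (fun x => by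
      constructor
      · intro hx i r hr
        rw [← Pi.smul_apply]
        change (r • e x) i = 0
        rw [← map_smul, hx r hr, map_zero, Pi.zero_apply]
      · intro hx r hr
        apply e.injective
        rw [map_smul, map_zero]
        ext i
        exact hx i r hr)).trans (Equiv.subtypePiEquivPi
          (p := fun (i : t) (x : R ⧸ i.1.asIdeal) => ∀ r ∈ m.asIdeal, r • x = 0))
  rw [Nat.card_congr e1, Nat.card_pi, Finset.prod_congr rfl fun i _ =>
    natCard_torsion_quotient m i.1]
  have h2 := congrArg (fun s : Multiset (MaximalSpectrum R) =>
    (s.map fun n => if n = m then Nat.card (R ⧸ m.asIdeal) else 1).prod) (Multiset.map_univ_coe t)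
  simp only [Multiset.map_map] at h2
  refine Eq.trans h2 ?_
  clear h2 e1 e
  induction t using Multiset.induction_on with
  | empty => simp
  | cons a t ih =>
    rw [Multiset.map_cons, Multiset.prod_cons, ih, Multiset.count_cons]
    by_cases h : a = m
    · simp [h, pow_succ']
    · simp [h, Ne.symm h]

theorem HasResidueType.finite_quotient [Finite V] (h : HasResidueType R V t)
    {m : MaximalSpectrum R} (hm : m ∈ t) : Finite (R ⧸ m.asIdeal) := by
  classical
  obtain ⟨e⟩ := h
  have : Finite (ResidueModule t) := Finite.of_equiv _ e.toEquiv
  let i : t := ⟨m, ⟨0, Multiset.count_pos.2 hm⟩⟩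
  exact Finite.of_surjective (fun x : ResidueModule t => x i) (Function.surjective_eval i)

theorem HasResidueType.unique [Finite V] (h : HasResidueType R V s) (h' : HasResidueType R V t) :
    s = t := by
  classical
  ext m
  -- Only for an ideal that occurs is the residue field known to be finite, which is needed to
  -- recover the exponent from the power.
  by_cases hm : m ∈ s ∨ m ∈ t
  · have : Finite (R ⧸ m.asIdeal) := hm.elim h.finite_quotient h'.finite_quotient
    have := Ideal.Quotient.nontrivial_iff.2 m.isMaximal.ne_top
    exact Nat.pow_right_injective (Finite.one_lt_card (α := R ⧸ m.asIdeal))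
      ((h.natCard_torsion m).symm.trans (h'.natCard_torsion m))
  · push Not at hm
    rw [Multiset.count_eq_zero_of_notMem hm.1, Multiset.count_eq_zero_of_notMem hm.2]

theorem hasResidueType_zero [Subsingleton V] : HasResidueType R V 0 := by
  classical
  have : Unique (ResidueModule (R := R) 0) := Pi.uniqueOfIsEmpty _
  exact ⟨LinearEquiv.ofBijective 0
    ⟨fun _ _ _ => Subsingleton.elim _ _, fun _ => ⟨0, Subsingleton.elim _ _⟩⟩⟩

theorem HasResidueType.exists_submodule (h : HasResidueType R V t) (hs : s ≤ t) :
    ∃ U : Submodule R V, HasResidueType R U s := by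
  obtain ⟨u, rfl⟩ := Multiset.le_iff_exists_add.1 hs
  obtain ⟨e⟩ := ((hasResidueType_residueModule s).prod
    (hasResidueType_residueModule u)).nonempty_equiv h
  let φ : ResidueModule s →ₗ[R] V := e.toLinearMap ∘ₗ LinearMap.inl R _ _
  have hφ : Function.Injective φ := e.injective.comp LinearMap.inl_injective
  exact ⟨LinearMap.range φ, ⟨(LinearEquiv.ofInjective φ hφ).symm⟩⟩

theorem HasResidueType.add_of_isCompl {U U' : Submodule R V} (hU : IsCompl U U')
    (h : HasResidueType R U s) (h' : HasResidueType R U' t) : HasResidueType R V (s + t) :=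
  (h.prod h').congr (U.prodEquivOfIsCompl U' hU).symm

theorem HasResidueType.le [Finite V] (h : HasResidueType R V t) {U : Submodule R V}
    (hU : HasResidueType R U s) : s ≤ t := by
  have := h.isSemisimpleModule
  obtain ⟨W, hW⟩ := exists_isCompl U
  obtain ⟨u, hu⟩ := exists_hasResidueType (R := R) (V := W)
  rw [h.unique (hU.add_of_isCompl hW hu)]
  exact Multiset.le_add_right _ _

/-- If `U` and `U'` have the same type, then so do their complements, by cancellation in the type of
`V`. Isomorphisms of the summands glue to an automorphism of `V`. -/
theorem exists_smul_submodule_eq_iff [Finite V] [IsSemisimpleModule R V] {U U' : Submodule R V}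
    (h : HasResidueType R U s) (h' : HasResidueType R U' t) :
    s = t ↔ ∃ g : V ≃ₗ[R] V, g • U = U' := by
  constructor
  · rintro rfl
    obtain ⟨W, hW⟩ := exists_isCompl U
    obtain ⟨W', hW'⟩ := exists_isCompl U'
    obtain ⟨u, hu⟩ := exists_hasResidueType (R := R) (V := W)
    obtain ⟨u', hu'⟩ := exists_hasResidueType (R := R) (V := W')
    obtain rfl : u = u' :=
      add_left_cancel ((h.add_of_isCompl hW hu).unique (h'.add_of_isCompl hW' hu'))
    obtain ⟨a⟩ := h.nonempty_equiv h'
    obtain ⟨b⟩ := hu.nonempty_equiv hu'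
    set φ : V ≃ₗ[R] V := (U.prodEquivOfIsCompl W hW).symm ≪≫ₗ
      (a.prodCongr b) ≪≫ₗ U'.prodEquivOfIsCompl W' hW' with hφ
    have hφU : ∀ x : U, φ x = a x := fun x => by simp [hφ]
    refine ⟨φ, ?_⟩
    ext x
    rw [mem_smul_submodule_iff]
    constructor
    · rintro ⟨y, hy, rfl⟩
      rw [hφU ⟨y, hy⟩]
      exact (a _).2
    · intro hx
      exact ⟨a.symm ⟨x, hx⟩, (a.symm _).2, by rw [hφU]; simp⟩
  · rintro ⟨g, rfl⟩
    exact h.unique (h'.congr (g.submoduleMap U))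

end ModuleTypes

/-! ### The average Möbius number of a semisimple module -/

section MeanMobius

/-- By the orbit-stabilizer theorem each orbit contributes `|G|` times the value of `F` on it. A
fibre of `T` has to be an orbit only where `F` is nonzero, so all non-semisimple modules may later
share one label of value zero. -/
theorem sum_card_stabilizer_mul {G X τ : Type*} [Group G] [Finite G] [MulAction G X] [Fintype X]
    [DecidableEq τ]
    (T : X → τ) (F : τ → ℚ) (hT : ∀ x y, F (T x) ≠ 0 → (T x = T y ↔ ∃ g : G, g • x = y)) :
    ∑ x, (Nat.card (MulAction.stabilizer G x) : ℚ) * F (T x) =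
      Nat.card G * ∑ t ∈ Finset.univ.image T, F t := by
  have := Fintype.ofFinite G
  rw [Finset.mul_sum, ← Finset.sum_fiberwise_of_maps_to (s := Finset.univ) (g := T)
    (fun x _ => Finset.mem_image_of_mem T (Finset.mem_univ x))]
  refine Finset.sum_congr rfl fun t ht => ?_
  obtain ⟨x, -, rfl⟩ := Finset.mem_image.1 ht
  by_cases h0 : F (T x) = 0
  · rw [h0, mul_zero]
    refine Finset.sum_eq_zero fun y hy => ?_
    rw [(Finset.mem_filter.1 hy).2, h0, mul_zero]
  set S := Finset.univ.filter fun y => T y = T x with hS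
  have hSpos : (S.card : ℚ) ≠ 0 := by
    have : x ∈ S := by simp [hS]
    exact_mod_cast (Finset.card_pos.2 ⟨x, this⟩).ne'
  have hy : ∀ y ∈ S, (Nat.card (MulAction.stabilizer G y) : ℚ) * F (T y) =
      Nat.card G * F (T x) / S.card := by
    intro y hy
    have hyx := (Finset.mem_filter.1 hy).2
    have horb : (S : Set X) = MulAction.orbit G y := by
      ext z
      rw [Finset.mem_coe, hS, Finset.mem_filter, ← hyx, MulAction.mem_orbit_iff,
        ← hT y z (hyx ▸ h0)]
      simp [eq_comm]
    have hcard : S.card * Nat.card (MulAction.stabilizer G y) = Nat.card G := by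
      rw [← Nat.card_congr (MulAction.orbitProdStabilizerEquivGroup G y), Nat.card_prod, ← horb]
      simp
    rw [hyx, ← hcard, Nat.cast_mul]
    field_simp
  rw [Finset.sum_congr rfl hy, Finset.sum_const, nsmul_eq_mul]
  field_simp

variable {R : Type*} [CommRing R]

theorem fixedMobius_conj {V W : Type*} [AddCommGroup V] [Module R V] [Finite V] [AddCommGroup W]
    [Module R W] [Finite W] (e : V ≃ₗ[R] W) (g : V ≃ₗ[R] V) :
    fixedMobius (e.symm ≪≫ₗ g ≪≫ₗ e) = fixedMobius g := by
  have h : ∀ U : Submodule R V, (e.symm ≪≫ₗ g ≪≫ₗ e) • U.map (e : V →ₗ[R] W) =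
      (g • U).map (e : V →ₗ[R] W) := by
    intro U
    ext x
    simp only [mem_smul_submodule_iff, Submodule.mem_map]
    constructor
    · rintro ⟨_, ⟨y, hy, rfl⟩, rfl⟩
      exact ⟨_, ⟨y, hy, rfl⟩, by simp⟩
    · rintro ⟨_, ⟨y, hy, rfl⟩, rfl⟩
      exact ⟨_, ⟨y, hy, rfl⟩, by simp⟩
  have hinj := Submodule.map_injective_of_injective (f := (e : V →ₗ[R] W)) e.injective
  have hiff : ∀ U : Submodule R V, (e.symm ≪≫ₗ g ≪≫ₗ e) • U.map (e : V →ₗ[R] W) =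
      U.map (e : V →ₗ[R] W) ↔ g • U = U := fun U => by rw [h, hinj.eq_iff]
  have E : FixedSubmodules g ≃o FixedSubmodules (e.symm ≪≫ₗ g ≪≫ₗ e) :=
    { toEquiv := (Submodule.orderIsoMapComap e).toEquiv.subtypeEquiv fun U => (hiff U).symm
      map_rel_iff' := fun {a b} => (Submodule.orderIsoMapComap e).le_iff_le }
  refine bottomMobius_congr ⊤ (OrderIso.trans ?_ E.symm)
  exact
    { toFun := fun x => x.1
      invFun := fun x => ⟨x, Set.mem_Iic.2 le_top⟩
      left_inv := fun _ => rfl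
      right_inv := fun _ => rfl
      map_rel_iff' := Iff.rfl }

theorem meanMobius_congr {V W : Type*} [AddCommGroup V] [Module R V] [Finite V] [AddCommGroup W]
    [Module R W] [Finite W] (e : V ≃ₗ[R] W) : meanMobius R V = meanMobius R W := by
  let E : (V ≃ₗ[R] V) ≃ (W ≃ₗ[R] W) :=
    { toFun := fun g => e.symm ≪≫ₗ g ≪≫ₗ e
      invFun := fun g => e ≪≫ₗ g ≪≫ₗ e.symm
      left_inv := fun g => by ext; simp
      right_inv := fun g => by ext; simp }
  rw [meanMobius, meanMobius, Nat.card_congr E, ← finsum_comp_equiv E]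
  congr 1
  exact finsum_congr fun g => by rw [← fixedMobius_conj e g]; rfl

open Classical in
/-- `(-1) ^ |t|` for a multiset `t` without repetitions, and `0` for the others. -/
noncomputable def squarefreeSign {α : Type*} (t : Multiset α) : ℚ :=
  if t.Nodup then (-1) ^ Multiset.card t else 0

/-- The submultisets without repetition are the subsets of the nonempty support of `t`, and their
signs cancel. -/
theorem sum_squarefreeSign {α : Type*} [DecidableEq α] {t : Multiset α} (ht : t ≠ 0) :
    ∑ s ∈ t.powerset.toFinset, squarefreeSign s = 0 := by
  have hdef : ∀ s : Multiset α, squarefreeSign s = if s.Nodup then (-1) ^ Multiset.card s else 0 :=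
    fun s => by unfold squarefreeSign; congr
  rw [Finset.sum_congr rfl fun s _ => hdef s, ← Finset.sum_filter]
  have h := Finset.sum_powerset_neg_one_pow_card_of_nonempty (x := t.toFinset)
    (Multiset.toFinset_nonempty.2 ht)
  have h' : ∑ m ∈ t.toFinset.powerset, (-1 : ℚ) ^ m.card = 0 := by exact_mod_cast h
  rw [← h']
  refine Finset.sum_bij' (fun s _ => s.toFinset) (fun s _ => s.val) ?_ ?_ ?_ ?_ ?_
  · intro s hs
    simp only [Finset.mem_filter, Multiset.mem_toFinset, Multiset.mem_powerset] at hs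
    rw [Finset.mem_powerset]
    exact Multiset.toFinset_subset.2 (Multiset.subset_of_le hs.1)
  · intro s hs
    rw [Finset.mem_powerset] at hs
    simp only [Finset.mem_filter, Multiset.mem_toFinset, Multiset.mem_powerset]
    refine ⟨(Multiset.le_iff_subset s.nodup).2 fun x hx => ?_, s.nodup⟩
    exact Multiset.mem_toFinset.1 (hs hx)
  · intro s hs
    rw [Multiset.toFinset_val, (Finset.mem_filter.1 hs).2.dedup]
  · intro s hs
    exact Finset.val_toFinset s
  · intro s hs
    rw [Multiset.toFinset_card_of_nodup (Finset.mem_filter.1 hs).2]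

/-- Both sides, weighted by stabilizer orders and summed over all submodules, give zero. By
induction on the cardinality they agree on proper submodules, hence also on `⊤`. -/
theorem meanMobius_eq_squarefreeSign {V : Type*} [AddCommGroup V] [Module R V] [Finite V]
    {t : Multiset (MaximalSpectrum R)} (h : HasResidueType R V t) :
    meanMobius R V = squarefreeSign t := by
  classical
  induction hn : Nat.card V using Nat.strong_induction_on generalizing V t with
  | _ n ih =>
  subst hn
  rcases subsingleton_or_nontrivial V with hV | hV
  · rw [meanMobius_of_subsingleton, h.unique hasResidueType_zero]
    simp [squarefreeSign]
  have := h.isSemisimpleModule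
  have := Fintype.ofFinite (Submodule R V)
  have ht0 : t ≠ 0 := by
    rintro rfl
    obtain ⟨e⟩ := h
    have : Unique (ResidueModule (R := R) 0) := Pi.uniqueOfIsEmpty _
    exact not_subsingleton V e.toEquiv.subsingleton
  have hex : ∀ U : Submodule R V, ∃ s, HasResidueType R U s := fun U => exists_hasResidueType
  choose T hT using hex
  have himage : Finset.univ.image T = t.powerset.toFinset := by
    ext s
    simp only [Finset.mem_image, Finset.mem_univ, true_and, Multiset.mem_toFinset,
      Multiset.mem_powerset]
    constructor
    · rintro ⟨U, rfl⟩
      exact h.le (hT U)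
    · intro hs
      obtain ⟨U, hU⟩ := h.exists_submodule hs
      exact ⟨U, (hT U).unique hU⟩
  have h1 := sum_card_stabilizer_mul_meanMobius (R := R) (V := V)
  have h2 := sum_card_stabilizer_mul (G := V ≃ₗ[R] V) T squarefreeSign
    fun U U' _ => exists_smul_submodule_eq_iff (hT U) (hT U')
  rw [himage, sum_squarefreeSign ht0, mul_zero, ← h1] at h2
  rw [← Finset.add_sum_erase _ _ (Finset.mem_univ ⊤),
    ← Finset.add_sum_erase _ _ (Finset.mem_univ ⊤)] at h2
  rw [Finset.sum_congr rfl (g := fun U : Submodule R V =>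
    (Nat.card (MulAction.stabilizer (V ≃ₗ[R] V) U) : ℚ) * meanMobius R U) ?_] at h2
  · have hcard : (Nat.card (MulAction.stabilizer (V ≃ₗ[R] V) (⊤ : Submodule R V)) : ℚ) ≠ 0 := by
      exact_mod_cast Nat.card_pos.ne'
    have h3 := mul_left_cancel₀ hcard (add_right_cancel h2)
    rw [← meanMobius_congr (Submodule.topEquiv (R := R) (M := V)), ← h3,
      (hT ⊤).unique (h.congr Submodule.topEquiv)]
  · intro U hU
    have hU' : (U : Set V) ≠ Set.univ := fun hh =>
      (Finset.mem_erase.1 hU).1 (SetLike.coe_injective hh)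
    have hlt : Nat.card U < Nat.card V := by
      have := Set.ncard_lt_card hU'
      rwa [← Nat.card_coe_set_eq] at this
    rw [ih _ hlt (hT U) rfl]

end MeanMobius

/-! ### Homomorphisms to `GL(V)` as modules over the group algebra -/

section GroupModule

variable {K B V : Type*} [Field K] [CommGroup B] [AddCommGroup V] [Module K V]

/-- The `K[B]`-module given by a homomorphism from `B` to `GL(V)`. -/
abbrev HomModule (Y : B →* LinearMap.GeneralLinearGroup K V) : Type _ :=
  Representation.asModule ((Units.coeHom (V →ₗ[K] V)).comp Y : Representation K B V)

/-- The identity map from the module given by `Y` to `V`. -/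
noncomputable def homModuleEquiv (Y : B →* LinearMap.GeneralLinearGroup K V) :
    HomModule Y ≃ₗ[K] V :=
  Representation.asModuleEquiv ((Units.coeHom (V →ₗ[K] V)).comp Y : Representation K B V)

instance (Y : B →* LinearMap.GeneralLinearGroup K V) [Finite V] : Finite (HomModule Y) :=
  Finite.of_equiv V (homModuleEquiv Y).symm.toEquiv

theorem homModuleEquiv_of_smul (Y : B →* LinearMap.GeneralLinearGroup K V) (b : B)
    (x : HomModule Y) :
    homModuleEquiv Y (MonoidAlgebra.of K B b • x) = Y b • homModuleEquiv Y x := by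
  rw [homModuleEquiv, Representation.asModuleEquiv_map_smul, Representation.asAlgebraHom_of]
  rfl

/-- A `K`-linear equivalence commuting with the action of `B` is `K[B]`-linear. -/
noncomputable def LinearEquiv.extendGroupAlgebra {M N : Type*} [AddCommGroup M]
    [AddCommGroup N] [Module K M] [Module K N] [Module (MonoidAlgebra K B) M] [Module (MonoidAlgebra K B) N]
    [IsScalarTower K (MonoidAlgebra K B) M] [IsScalarTower K (MonoidAlgebra K B) N]
    (f : M ≃ₗ[K] N)
    (hf : ∀ (b : B) (x : M), f (MonoidAlgebra.of K B b • x) = MonoidAlgebra.of K B b • f x) :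
    M ≃ₗ[MonoidAlgebra K B] N :=
  { f with
    map_smul' := fun r x => by
      change f (r • x) = r • f x
      induction r using MonoidAlgebra.induction_on with
      | of b => exact hf b x
      | add a b ha hb => rw [add_smul, map_add, ha, hb, add_smul]
      | smul c a ha => rw [smul_assoc, map_smul, ha, smul_assoc] }

/-- The elements of `GL(V)` intertwining `Y` and `Y'` are the isomorphisms of `K[B]`-modules. -/
noncomputable def intertwinerEquiv (Y Y' : B →* LinearMap.GeneralLinearGroup K V) :
    {g : LinearMap.GeneralLinearGroup K V // ∀ b, g * Y b = Y' b * g} ≃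
      (HomModule Y ≃ₗ[MonoidAlgebra K B] HomModule Y') where
  toFun g := (homModuleEquiv Y ≪≫ₗ LinearMap.GeneralLinearGroup.toLinearEquiv g.1 ≪≫ₗ
    (homModuleEquiv Y').symm).extendGroupAlgebra fun b x => by
      apply (homModuleEquiv Y').injective
      rw [homModuleEquiv_of_smul]
      simp only [LinearEquiv.trans_apply, LinearEquiv.apply_symm_apply]
      change g.1 • homModuleEquiv Y (MonoidAlgebra.of K B b • x) =
        Y' b • g.1 • homModuleEquiv Y x
      rw [homModuleEquiv_of_smul]
      rw [← mul_smul, g.2, mul_smul]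
  invFun f := ⟨LinearMap.GeneralLinearGroup.ofLinearEquiv
    ((homModuleEquiv Y).symm ≪≫ₗ f.restrictScalars K ≪≫ₗ homModuleEquiv Y'), fun b => by
      ext x
      obtain ⟨x, rfl⟩ := (homModuleEquiv Y).surjective x
      change homModuleEquiv Y' (f ((homModuleEquiv Y).symm (Y b • homModuleEquiv Y x))) =
        Y' b • homModuleEquiv Y' (f ((homModuleEquiv Y).symm (homModuleEquiv Y x)))
      rw [← homModuleEquiv_of_smul, ← homModuleEquiv_of_smul, LinearEquiv.symm_apply_apply,
        LinearEquiv.symm_apply_apply, map_smul]⟩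
  left_inv g := by
    ext x
    rfl
  right_inv f := by
    ext x
    rfl

theorem intertwinerEquiv_apply (Y Y' : B →* LinearMap.GeneralLinearGroup K V)
    (g : {g : LinearMap.GeneralLinearGroup K V // ∀ b, g * Y b = Y' b * g}) (x : HomModule Y) :
    homModuleEquiv Y' (intertwinerEquiv Y Y' g x) = g.1 • homModuleEquiv Y x := rfl

/-- The subspaces of `V` preserved by `Y` are the submodules of the module given by `Y`. -/
noncomputable def homSubmoduleEquiv (Y : B →* LinearMap.GeneralLinearGroup K V) :
    Submodule (MonoidAlgebra K B) (HomModule Y) ≃o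
      {U : Submodule K V // ∀ b, Y b • U = U} where
  toFun U := ⟨(U.restrictScalars K).map (homModuleEquiv Y : HomModule Y →ₗ[K] V), by
    have hle : ∀ b, Y b • (U.restrictScalars K).map (homModuleEquiv Y : HomModule Y →ₗ[K] V) ≤
        (U.restrictScalars K).map (homModuleEquiv Y : HomModule Y →ₗ[K] V) := by
      rintro b _ ⟨_, ⟨x, hx, rfl⟩, rfl⟩
      refine ⟨MonoidAlgebra.of K B b • x, U.smul_mem _ hx, ?_⟩
      exact homModuleEquiv_of_smul Y b x
    intro b
    -- The reverse inclusion follows from `hle` for `b⁻¹`.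
    refine le_antisymm (hle b) fun x hx => ?_
    have h := Submodule.smul_mem_pointwise_smul _ (Y b) _
      (hle b⁻¹ (Submodule.smul_mem_pointwise_smul x (Y b⁻¹) _ hx))
    rwa [map_inv, smul_inv_smul] at h⟩
  invFun W :=
    { carrier := {x | homModuleEquiv Y x ∈ W.1}
      add_mem' := fun {x y} hx hy => by
        change homModuleEquiv Y (x + y) ∈ W.1
        rw [map_add]
        exact W.1.add_mem hx hy
      zero_mem' := by simp
      smul_mem' := fun r x hx => by
        induction r using MonoidAlgebra.induction_on with
        | of b =>
          change homModuleEquiv Y (MonoidAlgebra.of K B b • x) ∈ W.1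
          rw [homModuleEquiv_of_smul, ← W.2 b]
          exact Submodule.smul_mem_pointwise_smul _ _ _ hx
        | add a b ha hb =>
          rw [add_smul]
          change homModuleEquiv Y (_ + _) ∈ W.1
          rw [map_add]
          exact W.1.add_mem ha hb
        | smul c a ha =>
          rw [smul_assoc]
          change homModuleEquiv Y (c • _) ∈ W.1
          rw [map_smul]
          exact W.1.smul_mem c ha }
  left_inv U := by
    ext x
    change homModuleEquiv Y x ∈ (U.restrictScalars K).map _ ↔ _
    simp
  right_inv W := by
    ext x
    simp
  map_rel_iff' := by
    intro U U'
    exact Submodule.map_le_map_iff_of_injective (homModuleEquiv Y).injective _ _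

end GroupModule

/-! ### The Euler characteristic as a sum over homomorphisms from `B` -/

section FixedPoints

variable {K B V : Type*} [Field K] [CommGroup B] [AddCommGroup V] [Module K V]

theorem mem_homSubmoduleEquiv (Y : B →* LinearMap.GeneralLinearGroup K V)
    (U : Submodule (MonoidAlgebra K B) (HomModule Y)) (x : HomModule Y) :
    homModuleEquiv Y x ∈ (homSubmoduleEquiv Y U).1 ↔ x ∈ U := by
  change homModuleEquiv Y x ∈ (U.restrictScalars K).map
    (homModuleEquiv Y : HomModule Y →ₗ[K] V) ↔ _
  simp

theorem homSubmoduleEquiv_eq_bot_iff (Y : B →* LinearMap.GeneralLinearGroup K V)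
    (U : Submodule (MonoidAlgebra K B) (HomModule Y)) :
    (homSubmoduleEquiv Y U).1 = ⊥ ↔ U = ⊥ := by
  rw [Submodule.eq_bot_iff, Submodule.eq_bot_iff, (homModuleEquiv Y).surjective.forall]
  simp only [mem_homSubmoduleEquiv, LinearEquiv.map_eq_zero_iff]

theorem homSubmoduleEquiv_eq_top_iff (Y : B →* LinearMap.GeneralLinearGroup K V)
    (U : Submodule (MonoidAlgebra K B) (HomModule Y)) :
    (homSubmoduleEquiv Y U).1 = ⊤ ↔ U = ⊤ := by
  rw [Submodule.eq_top_iff', Submodule.eq_top_iff', (homModuleEquiv Y).surjective.forall]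
  simp only [mem_homSubmoduleEquiv]

theorem mem_generalLinearGroup_smul_iff (g : LinearMap.GeneralLinearGroup K V)
    (W : Submodule K V) (x : V) : x ∈ g • W ↔ ∃ y ∈ W, g • y = x :=
  Submodule.mem_smul_pointwise_iff_exists _ _ _

theorem homSubmoduleEquiv_smul (Y : B →* LinearMap.GeneralLinearGroup K V)
    (g : {g : LinearMap.GeneralLinearGroup K V // ∀ b, g * Y b = Y b * g})
    (U : Submodule (MonoidAlgebra K B) (HomModule Y)) :
    (homSubmoduleEquiv Y (intertwinerEquiv Y Y g • U)).1 = g.1 • (homSubmoduleEquiv Y U).1 := by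
  ext x
  obtain ⟨x, rfl⟩ := (homModuleEquiv Y).surjective x
  rw [mem_homSubmoduleEquiv, mem_smul_submodule_iff, mem_generalLinearGroup_smul_iff]
  constructor
  · rintro ⟨y, hy, rfl⟩
    exact ⟨_, (mem_homSubmoduleEquiv Y U y).2 hy, (intertwinerEquiv_apply Y Y g y).symm⟩
  · rintro ⟨y, hy, h⟩
    obtain ⟨y, rfl⟩ := (homModuleEquiv Y).surjective y
    refine ⟨y, (mem_homSubmoduleEquiv Y U y).1 hy, (homModuleEquiv Y).injective ?_⟩
    rw [intertwinerEquiv_apply, h]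

/-- The fixed points in the poset of proper subspaces are the proper submodules fixed by an
automorphism. -/
noncomputable def fixedPointsEquiv (H : Subgroup (LinearMap.GeneralLinearGroup K V))
    (Y : B →* LinearMap.GeneralLinearGroup K V)
    (g : {g : LinearMap.GeneralLinearGroup K V // ∀ b, g * Y b = Y b * g})
    (hH : ∀ W : Submodule K V, (∀ h ∈ H, h • W = W) ↔ g.1 • W = W ∧ ∀ b, Y b • W = W) :
    {U : FixedSubmodules (intertwinerEquiv Y Y g) // ⊥ < U ∧ U < ⊤} ≃o
      MulAction.fixedPoints H (properSubspaces K V) where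
  toFun U := ⟨⟨(homSubmoduleEquiv Y U.1.1).1,
      fun h => U.2.1.ne' (Subtype.ext ((homSubmoduleEquiv_eq_bot_iff Y _).1 h)),
      fun h => U.2.2.ne (Subtype.ext ((homSubmoduleEquiv_eq_top_iff Y _).1 h))⟩, fun h => by
    refine Subtype.ext ((hH _).2 ⟨?_, (homSubmoduleEquiv Y U.1.1).2⟩ h.1 h.2)
    rw [← homSubmoduleEquiv_smul, U.1.2]⟩
  invFun W := by
    have hW := (hH W.1.1).1 fun h hh => congrArg Subtype.val (W.2 ⟨h, hh⟩)
    have hU : (homSubmoduleEquiv Y ((homSubmoduleEquiv Y).symm ⟨W.1.1, hW.2⟩)).1 = W.1.1 := by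
      rw [OrderIso.apply_symm_apply]
    refine ⟨⟨(homSubmoduleEquiv Y).symm ⟨W.1.1, hW.2⟩, ?_⟩, ?_, ?_⟩
    · apply (homSubmoduleEquiv Y).injective
      apply Subtype.ext
      rw [homSubmoduleEquiv_smul, hU, hW.1]
    · refine bot_lt_iff_ne_bot.2 fun h => W.1.2.1 ?_
      rw [← hU, homSubmoduleEquiv_eq_bot_iff]
      exact congrArg Subtype.val h
    · refine lt_top_iff_ne_top.2 fun h => W.1.2.2 ?_
      rw [← hU, homSubmoduleEquiv_eq_top_iff]
      exact congrArg Subtype.val h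
  left_inv U := by
    apply Subtype.ext
    apply Subtype.ext
    exact (homSubmoduleEquiv Y).symm_apply_apply U.1.1
  right_inv W := by
    refine Subtype.ext (Subtype.ext (?_ : _ = W.1.1))
    have hW := (hH W.1.1).1 fun h hh => congrArg Subtype.val (W.2 ⟨h, hh⟩)
    change (homSubmoduleEquiv Y ((homSubmoduleEquiv Y).symm ⟨W.1.1, hW.2⟩)).1 = W.1.1
    rw [OrderIso.apply_symm_apply]
  map_rel_iff' := fun {U U'} => (homSubmoduleEquiv Y).le_iff_le (x := U.1.1) (y := U'.1.1)

theorem reducedEulerChar_fixedPoints [Finite V] [Nontrivial V]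
    (H : Subgroup (LinearMap.GeneralLinearGroup K V))
    (Y : B →* LinearMap.GeneralLinearGroup K V)
    (g : {g : LinearMap.GeneralLinearGroup K V // ∀ b, g * Y b = Y b * g})
    (hH : ∀ W : Submodule K V, (∀ h ∈ H, h • W = W) ↔ g.1 • W = W ∧ ∀ b, Y b • W = W) :
    reducedEulerChar (MulAction.fixedPoints H (properSubspaces K V)) =
      fixedMobius (intertwinerEquiv Y Y g) := by
  have : Nontrivial (HomModule Y) := (homModuleEquiv Y).toEquiv.nontrivial
  have : Nontrivial (FixedSubmodules (intertwinerEquiv Y Y g)) :=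
    ⟨⊥, ⊤, fun h => bot_ne_top (congrArg Subtype.val h)⟩
  rw [fixedMobius, bottomMobius_top_eq (fixedPointsEquiv H Y g hH)]

/-- A homomorphism from `ℤ × B` consists of a homomorphism from `B` and an element commuting with
its image. -/
noncomputable def homIntProdEquiv {A G : Type*} [Group A] [Group G]
    (e : A ≃* Multiplicative ℤ × B) :
    (A →* G) ≃ (Y : B →* G) × {g : G // ∀ b, g * Y b = Y b * g} where
  toFun X := ⟨(X.comp e.symm.toMonoidHom).comp (MonoidHom.inr _ _),
    X (e.symm (Multiplicative.ofAdd 1, 1)), fun b => by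
      change X (e.symm (Multiplicative.ofAdd 1, 1)) * X (e.symm (1, b)) =
        X (e.symm (1, b)) * X (e.symm (Multiplicative.ofAdd 1, 1))
      rw [← map_mul, ← map_mul, ← map_mul, ← map_mul, Prod.mk_mul_mk, Prod.mk_mul_mk]
      simp⟩
  invFun Z := ((zpowersHom G Z.2.1).noncommCoprod Z.1 fun m b => by
    rw [zpowersHom_apply]
    exact Commute.zpow_left (Z.2.2 b) _).comp e.toMonoidHom
  left_inv X := by
    ext a
    obtain ⟨⟨m, b⟩, rfl⟩ := e.symm.surjective a
    simp only [MonoidHom.comp_apply, MulEquiv.toMonoidHom_eq_coe, MonoidHom.coe_coe,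
      MonoidHom.noncommCoprod_apply, MulEquiv.apply_symm_apply, zpowersHom_apply,
      MonoidHom.inr_apply]
    rw [← map_zpow, ← map_mul, ← map_zpow, ← map_mul, Prod.pow_mk, Prod.mk_mul_mk, one_zpow,
      one_mul, mul_one, ← ofAdd_zsmul]
    simp
  right_inv Z := by
    obtain ⟨Y, g, hg⟩ := Z
    have hY : ((((zpowersHom G g).noncommCoprod Y fun m b => by
        rw [zpowersHom_apply]; exact Commute.zpow_left (hg b) _).comp e.toMonoidHom).comp
        e.symm.toMonoidHom).comp (MonoidHom.inr _ _) = Y := by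
      ext b
      simp
    refine Sigma.subtype_ext hY ?_
    simp

theorem forall_mem_range_smul_eq_iff {A G P : Type*} [Group A] [Group G] [MulAction G P]
    (e : A ≃* Multiplicative ℤ × B) (X : A →* G) (W : P) :
    (∀ h ∈ X.range, h • W = W) ↔ (homIntProdEquiv e X).2.1 • W = W ∧
      ∀ b, (homIntProdEquiv e X).1 b • W = W := by
  constructor
  · intro h
    exact ⟨h _ ⟨_, rfl⟩, fun b => h _ ⟨_, rfl⟩⟩
  · rintro ⟨h1, h2⟩ _ ⟨a, rfl⟩
    have h3 : X a = (homIntProdEquiv e X).2.1 ^ (Multiplicative.toAdd (e a).1) *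
        (homIntProdEquiv e X).1 (e a).2 := by
      conv_lhs => rw [← (homIntProdEquiv e).symm_apply_apply X]
      rfl
    rw [h3, mul_smul, h2]
    exact (MulAction.stabilizer G W).zpow_mem h1 _

/-- Group the homomorphisms from `ℤ × B` by their restriction `Y` to `B`. The image of the generator
of `ℤ` then runs over the centralizer of `Y`, which is the automorphism group of the module, so the
inner sum is an average times the order of that group. -/
theorem equivariantReducedEulerChar_eq_sum {A : Type*} [Group A]
    (e : A ≃* Multiplicative ℤ × B) [Finite V] [Nontrivial V]
    [Finite (A →* LinearMap.GeneralLinearGroup K V)]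
    [Fintype (B →* LinearMap.GeneralLinearGroup K V)] :
    equivariantReducedEulerChar A (LinearMap.GeneralLinearGroup K V) (properSubspaces K V) =
      (∑ Y : B →* LinearMap.GeneralLinearGroup K V,
        (Nat.card {g : LinearMap.GeneralLinearGroup K V // ∀ b, g * Y b = Y b * g} : ℚ) *
          meanMobius (MonoidAlgebra K B) (HomModule Y)) /
        Nat.card (LinearMap.GeneralLinearGroup K V) := by
  classical
  have := Fintype.ofFinite (LinearMap.GeneralLinearGroup K V)
  rw [equivariantReducedEulerChar]
  congr 1
  have hY : ∀ Y : B →* LinearMap.GeneralLinearGroup K V,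
      (Nat.card {g : LinearMap.GeneralLinearGroup K V // ∀ b, g * Y b = Y b * g} : ℚ) *
          meanMobius (MonoidAlgebra K B) (HomModule Y) =
      ∑ g : {g : LinearMap.GeneralLinearGroup K V // ∀ b, g * Y b = Y b * g},
        (fixedMobius (intertwinerEquiv Y Y g) : ℚ) := by
    intro Y
    have := Fintype.ofFinite (HomModule Y ≃ₗ[MonoidAlgebra K B] HomModule Y)
    rw [meanMobius, Nat.card_congr (intertwinerEquiv Y Y), finsum_eq_sum_of_fintype,
      mul_div_cancel₀ _ (by exact_mod_cast Nat.card_pos.ne')]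
    exact (Equiv.sum_comp (intertwinerEquiv Y Y) fun g => (fixedMobius g : ℚ)).symm
  rw [Finset.sum_congr rfl fun Y _ => hY Y, ← Fintype.sum_sigma']
  refine Finset.sum_bij (fun X _ => homIntProdEquiv e X) (fun _ _ => Finset.mem_univ _)
    (fun _ _ _ _ h => (homIntProdEquiv e).injective h)
    (fun Z _ => ⟨(homIntProdEquiv e).symm Z, by simp, by simp⟩) fun X _ => ?_
  rw [reducedEulerChar_fixedPoints X.range (homIntProdEquiv e X).1 (homIntProdEquiv e X).2
    (forall_mem_range_smul_eq_iff e X)]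

end FixedPoints

/-! ### Reduction to signed sets of maximal ideals -/

section ResidueDegree

variable {K B V : Type*} [Field K] [CommGroup B] [AddCommGroup V] [Module K V]

/-- The degree over `K` of the residue field of a maximal ideal of `K[B]`. -/
noncomputable def residueDegree (m : MaximalSpectrum (MonoidAlgebra K B)) : ℕ :=
  Module.finrank K (MonoidAlgebra K B ⧸ m.asIdeal)

theorem residueDegree_pos [Finite K] {m : MaximalSpectrum (MonoidAlgebra K B)}
    [Finite (MonoidAlgebra K B ⧸ m.asIdeal)] : 0 < residueDegree m := by
  have := Ideal.Quotient.nontrivial_iff.2 m.isMaximal.ne_top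
  exact Module.finrank_pos

theorem HasResidueType.finrank_eq {M : Type*} [AddCommGroup M] [Module K M]
    [Module (MonoidAlgebra K B) M] [IsScalarTower K (MonoidAlgebra K B) M]
    {t : Multiset (MaximalSpectrum (MonoidAlgebra K B))}
    (h : HasResidueType (MonoidAlgebra K B) M t)
    (ht : ∀ m ∈ t, Module.Finite K (MonoidAlgebra K B ⧸ m.asIdeal)) :
    Module.finrank K M = (t.map residueDegree).sum := by
  classical
  obtain ⟨e⟩ := h
  have : ∀ i : t, Module.Finite K (MonoidAlgebra K B ⧸ i.1.asIdeal) := fun i =>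
    ht i.1 (Multiset.coe_mem)
  rw [(e.restrictScalars K).finrank_eq, Module.finrank_pi_fintype]
  have h2 := congrArg (fun s => (s.map residueDegree).sum) (Multiset.map_univ_coe t)
  simp only [Multiset.map_map] at h2
  exact h2

/-- Guarantees that every isomorphism class of modules of the right dimension occurs among the
`HomModule Y`. -/
theorem exists_homModule_equiv {M : Type*} [AddCommGroup M] [Module K M]
    [Module (MonoidAlgebra K B) M] [IsScalarTower K (MonoidAlgebra K B) M] (e : M ≃ₗ[K] V) :
    ∃ Y : B →* LinearMap.GeneralLinearGroup K V,
      Nonempty (HomModule Y ≃ₗ[MonoidAlgebra K B] M) := by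
  let φ : B →* (V →ₗ[K] V) :=
    { toFun := fun b => e.toLinearMap ∘ₗ
        (Algebra.lsmul K K M (MonoidAlgebra.of K B b)) ∘ₗ e.symm.toLinearMap
      map_one' := by
        ext x
        change e (MonoidAlgebra.of K B 1 • e.symm x) = x
        rw [map_one, one_smul, LinearEquiv.apply_symm_apply]
      map_mul' := fun a b => by
        ext x
        change e (MonoidAlgebra.of K B (a * b) • e.symm x) =
          e (MonoidAlgebra.of K B a • e.symm (e (MonoidAlgebra.of K B b • e.symm x)))
        rw [LinearEquiv.symm_apply_apply, map_mul, mul_smul] }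
  refine ⟨φ.toHomUnits, ⟨((homModuleEquiv φ.toHomUnits).trans e.symm).extendGroupAlgebra ?_⟩⟩
  intro b x
  rw [LinearEquiv.trans_apply, LinearEquiv.trans_apply, homModuleEquiv_of_smul]
  change e.symm (e (MonoidAlgebra.of K B b • e.symm (homModuleEquiv _ x))) = _
  rw [LinearEquiv.symm_apply_apply]

/-- Under conjugation the orbits of `GL(V)` on the `Y` are the isomorphism classes of modules and
the stabilizers are the centralizers, so each class counts once. As `finrank` is `0` in infinite
dimension, `0 < residueDegree m` selects the ideals with residue field finite over `K`. -/
theorem sum_card_centralizer_mul_meanMobius [Finite K] [Finite V]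
    [Fintype (B →* LinearMap.GeneralLinearGroup K V)]
    (S : Finset (MaximalSpectrum (MonoidAlgebra K B)))
    (hS : ∀ m, m ∈ S → 0 < residueDegree m)
    (hS' : ∀ m, 0 < residueDegree m → residueDegree m ≤ Module.finrank K V → m ∈ S) :
    (∑ Y : B →* LinearMap.GeneralLinearGroup K V,
        (Nat.card {g : LinearMap.GeneralLinearGroup K V // ∀ b, g * Y b = Y b * g} : ℚ) *
          meanMobius (MonoidAlgebra K B) (HomModule Y)) /
        Nat.card (LinearMap.GeneralLinearGroup K V) =
      ∑ s ∈ S.powerset.filter (fun s => ∑ m ∈ s, residueDegree m = Module.finrank K V),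
        (-1 : ℚ) ^ s.card := by
  classical
  -- The label of `Y` is its type when the module is semisimple and `none` otherwise; `F` below is
  -- `0` on `none`.
  have hex : ∀ Y : B →* LinearMap.GeneralLinearGroup K V,
      ∃ o : Option (Multiset (MaximalSpectrum (MonoidAlgebra K B))),
        ∀ t, o = some t ↔ HasResidueType (MonoidAlgebra K B) (HomModule Y) t := by
    intro Y
    by_cases h : ∃ t, HasResidueType (MonoidAlgebra K B) (HomModule Y) t
    · obtain ⟨t, ht⟩ := h
      exact ⟨some t, fun u => ⟨fun h => Option.some.inj h ▸ ht, fun h => by rw [ht.unique h]⟩⟩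
    · push Not at h
      exact ⟨none, fun u => ⟨fun h => by simp at h, fun h' => absurd h' (h u)⟩⟩
  choose T hT using hex
  let F : Option (Multiset (MaximalSpectrum (MonoidAlgebra K B))) → ℚ :=
    fun o => o.elim 0 squarefreeSign
  have hmean : ∀ Y, meanMobius (MonoidAlgebra K B) (HomModule Y) = F (T Y) := by
    intro Y
    by_cases h : IsSemisimpleModule (MonoidAlgebra K B) (HomModule Y)
    · obtain ⟨t, ht⟩ := exists_hasResidueType (R := MonoidAlgebra K B) (V := HomModule Y)
      rw [(hT Y t).2 ht]
      exact meanMobius_eq_squarefreeSign ht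
    · have : T Y = none := by
        rw [Option.eq_none_iff_forall_ne_some]
        exact fun t ht => h ((hT Y t).1 ht).isSemisimpleModule
      rw [this, meanMobius_eq_zero h]
      rfl
  let _ : MulAction (LinearMap.GeneralLinearGroup K V) (B →* LinearMap.GeneralLinearGroup K V) :=
    { smul := fun g Y => (MulAut.conj g).toMonoidHom.comp Y
      one_smul := fun Y => by
        change (MulAut.conj 1).toMonoidHom.comp Y = Y
        ext1 b; simp
      mul_smul := fun g h Y => by
        change (MulAut.conj (g * h)).toMonoidHom.comp Y =
          (MulAut.conj g).toMonoidHom.comp ((MulAut.conj h).toMonoidHom.comp Y)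
        ext1 b; simp }
  have hsmul : ∀ (g : LinearMap.GeneralLinearGroup K V)
      (Y Y' : B →* LinearMap.GeneralLinearGroup K V),
      g • Y = Y' ↔ ∀ b, g * Y b = Y' b * g := by
    intro g Y Y'
    rw [MonoidHom.ext_iff]
    refine forall_congr' fun b => ?_
    change g * Y b * g⁻¹ = Y' b ↔ _
    rw [mul_inv_eq_iff_eq_mul]
  have hsum := sum_card_stabilizer_mul (G := LinearMap.GeneralLinearGroup K V) T F (by
    intro Y Y' hF
    obtain ⟨t, ht⟩ : ∃ t, T Y = some t := by
      rw [← Option.ne_none_iff_exists']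
      intro h
      exact hF (by rw [h]; rfl)
    rw [ht, eq_comm, hT]
    rw [hT] at ht
    constructor
    · intro ht'
      obtain ⟨f⟩ := ht.nonempty_equiv ht'
      exact ⟨_, (hsmul _ _ _).2 ((intertwinerEquiv Y Y').symm f).2⟩
    · rintro ⟨g, hg⟩
      exact ht.congr (intertwinerEquiv Y Y' ⟨g, (hsmul _ _ _).1 hg⟩).symm)
  have hstab : ∀ Y : B →* LinearMap.GeneralLinearGroup K V,
      Nat.card (MulAction.stabilizer (LinearMap.GeneralLinearGroup K V) Y) =
        Nat.card {g : LinearMap.GeneralLinearGroup K V // ∀ b, g * Y b = Y b * g} := fun Y =>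
    Nat.card_congr (Equiv.subtypeEquivRight fun g => hsmul g Y Y)
  simp only [hstab, ← hmean] at hsum
  rw [hsum, mul_div_cancel_left₀ _ (by exact_mod_cast Nat.card_pos.ne')]
  let j : Finset (MaximalSpectrum (MonoidAlgebra K B)) →
    Option (Multiset (MaximalSpectrum (MonoidAlgebra K B))) := fun s => some s.val
  have hj : Function.Injective j := fun s s' h => Finset.val_injective (Option.some.inj h)
  have hFj : ∀ s, F (j s) = (-1 : ℚ) ^ s.card := fun s => by
    change squarefreeSign s.val = _
    rw [squarefreeSign, if_pos s.nodup, Finset.card_val]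
  rw [← Finset.sum_congr rfl fun s _ => hFj s, ← Finset.sum_image hj.injOn]
  -- Each set of ideals of the right total degree is realized by some `Y`. Any other label that
  -- occurs is `none` or has a repetition, so `F` vanishes on it.
  refine (Finset.sum_subset ?_ ?_).symm
  · intro o ho
    obtain ⟨s, hs, rfl⟩ := Finset.mem_image.1 ho
    obtain ⟨hsS, hdeg⟩ := Finset.mem_filter.1 hs
    rw [Finset.mem_powerset] at hsS
    have hfin : ∀ m ∈ s.val, Module.Finite K (MonoidAlgebra K B ⧸ m.asIdeal) := fun m hm =>
      Module.finite_of_finrank_pos (hS m (hsS hm))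
    have hty := hasResidueType_residueModule s.val
    have hrank := HasResidueType.finrank_eq (K := K) (B := B) hty hfin
    have : ∀ i : s.val, Module.Finite K (MonoidAlgebra K B ⧸ i.1.asIdeal) := fun i =>
      hfin i.1 Multiset.coe_mem
    obtain ⟨Y, ⟨e⟩⟩ := exists_homModule_equiv (V := V)
      (B := B) (LinearEquiv.ofFinrankEq (ResidueModule s.val) V (hrank.trans hdeg))
    exact Finset.mem_image.2 ⟨Y, Finset.mem_univ _, (hT Y _).2 (hty.congr e)⟩
  · intro o ho ho'
    obtain ⟨Y, -, hY⟩ := Finset.mem_image.1 ho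
    by_contra hF
    obtain ⟨t, rfl⟩ : ∃ t, o = some t := by
      rw [← Option.ne_none_iff_exists']
      rintro rfl
      exact hF rfl
    have hnd : t.Nodup := by
      by_contra hnd
      exact hF (if_neg hnd)
    have hty := (hT Y t).1 hY
    have hfin : ∀ m ∈ t, Finite (MonoidAlgebra K B ⧸ m.asIdeal) := fun m hm =>
      hty.finite_quotient hm
    have hrank := hty.finrank_eq fun m hm => by
      have := hfin m hm
      infer_instance
    rw [(homModuleEquiv Y).finrank_eq] at hrank
    refine ho' (Finset.mem_image.2 ⟨⟨t, hnd⟩, Finset.mem_filter.2 ⟨?_, hrank.symm⟩, rfl⟩)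
    rw [Finset.mem_powerset]
    intro m hm
    have := hfin m hm
    refine hS' m residueDegree_pos ?_
    rw [hrank]
    exact Multiset.single_le_sum (fun _ _ => Nat.zero_le _) _ (Multiset.mem_map_of_mem _ hm)

end ResidueDegree

/-! ### Generating function and logarithmic derivative -/

section SignedSubsetSums

open PowerSeries

theorem coeff_prod_one_sub_X_pow {α : Type*} (S : Finset α) (d : α → ℕ) (n : ℕ) :
    coeff n (∏ m ∈ S, (1 - X ^ d m : PowerSeries ℚ)) =
      ∑ s ∈ S.powerset.filter (fun s => ∑ m ∈ s, d m = n), (-1 : ℚ) ^ s.card := by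
  have h : ∀ m ∈ S, (1 - X ^ d m : PowerSeries ℚ) = 1 + -X ^ d m := fun m _ => sub_eq_add_neg _ _
  rw [Finset.prod_congr rfl h, Finset.prod_one_add, map_sum, Finset.sum_filter]
  refine Finset.sum_congr rfl fun s _ => ?_
  rw [Finset.prod_neg, Finset.prod_pow_eq_pow_sum]
  have h2 : ((-1) ^ s.card : PowerSeries ℚ) = C ((-1 : ℚ) ^ s.card) := by simp
  rw [h2, coeff_C_mul, coeff_X_pow]
  by_cases hn : ∑ m ∈ s, d m = n
  · simp [hn]
  · simp [hn, Ne.symm hn]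

/-- The geometric series `X^d + X^(2d) + ⋯`; the condition `j ≠ 0` excludes a constant term, as `d ∣
0`. -/
theorem mk_dvd_mul_one_sub_X_pow {d : ℕ} (hd : 0 < d) :
    (PowerSeries.mk fun j => if j ≠ 0 ∧ d ∣ j then (1 : ℚ) else 0) * (1 - X ^ d) = X ^ d := by
  ext j
  rw [mul_sub, mul_one, map_sub, coeff_mul_X_pow', coeff_mk, coeff_X_pow, coeff_mk]
  by_cases hj : d ≤ j
  · obtain ⟨k, rfl⟩ := Nat.exists_eq_add_of_le hj
    rcases Nat.eq_zero_or_pos k with rfl | hk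
    · simp [hd.ne']
    · simp [hk.ne', hd.ne']
  · have h1 : ¬ (j ≠ 0 ∧ d ∣ j) := fun h => hj (Nat.le_of_dvd (Nat.pos_of_ne_zero h.1) h.2)
    have h2 : j ≠ d := fun h => hj h.ge
    rw [if_neg h1, if_neg hj, if_neg h2, sub_zero]

/-- The logarithmic derivative of the product, cleared of denominators: the factor of `m`
contributes `-d X^d / (1 - X^d)` with `d = d m`. -/
theorem X_mul_derivative_prod_one_sub_X_pow {α : Type*} (S : Finset α) (d : α → ℕ)
    (hd : ∀ m ∈ S, 0 < d m) :
    X * derivative ℚ (∏ m ∈ S, (1 - X ^ d m : PowerSeries ℚ)) =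
      -(∑ m ∈ S, (d m : PowerSeries ℚ) *
        PowerSeries.mk fun j => if j ≠ 0 ∧ d m ∣ j then (1 : ℚ) else 0) *
        ∏ m ∈ S, (1 - X ^ d m) := by
  classical
  induction S using Finset.induction_on with
  | empty => simp
  | insert m S hm ih =>
    have hm0 := hd m (Finset.mem_insert_self m S)
    have ih' := ih fun m' hm' => hd m' (Finset.mem_insert_of_mem hm')
    have hE := mk_dvd_mul_one_sub_X_pow hm0
    have hX : (X : PowerSeries ℚ) * derivative ℚ (1 - X ^ d m : PowerSeries ℚ) =
        -((d m : PowerSeries ℚ) * X ^ d m) := by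
      obtain ⟨k, hk⟩ := Nat.exists_eq_succ_of_ne_zero hm0.ne'
      rw [map_sub, Derivation.map_one_eq_zero, zero_sub, Derivation.leibniz_pow, hk]
      simp [derivative_X]
      ring
    rw [Finset.prod_insert hm, Finset.sum_insert hm, Derivation.leibniz, smul_eq_mul, smul_eq_mul]
    linear_combination (1 - X ^ d m) * ih' + (∏ m ∈ S, (1 - X ^ d m)) * hX +
      (d m : PowerSeries ℚ) * (∏ m ∈ S, (1 - X ^ d m)) * hE

theorem mul_sum_signed_subsets {α : Type*} (S : Finset α) (d : α → ℕ) (hd : ∀ m ∈ S, 0 < d m)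
    (n : ℕ) :
    (n : ℚ) * ∑ s ∈ S.powerset.filter (fun s => ∑ m ∈ s, d m = n), (-1 : ℚ) ^ s.card =
      -∑ j ∈ Finset.Icc 1 n, ((∑ m ∈ S.filter (fun m => d m ∣ j), d m : ℕ) : ℚ) *
        ∑ s ∈ S.powerset.filter (fun s => ∑ m ∈ s, d m = n - j), (-1 : ℚ) ^ s.card := by
  rcases Nat.eq_zero_or_pos n with rfl | hn
  · simp
  have h := congrArg (coeff n) (X_mul_derivative_prod_one_sub_X_pow S d hd)
  simp only [← coeff_prod_one_sub_X_pow]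
  obtain ⟨k, rfl⟩ := Nat.exists_eq_succ_of_ne_zero hn.ne'
  rw [Nat.succ_eq_add_one, coeff_succ_X_mul, coeff_derivative, neg_mul, map_neg, coeff_mul,
    Finset.Nat.sum_antidiagonal_eq_sum_range_succ_mk, Finset.sum_range_succ'] at h
  -- The logarithmic derivative has no constant term, so the convolution runs over `1 ≤ j ≤ n` only.
  have h0 : ∀ j, coeff j (∑ m ∈ S, (d m : PowerSeries ℚ) *
      PowerSeries.mk fun j => if j ≠ 0 ∧ d m ∣ j then (1 : ℚ) else 0) =
      if j = 0 then 0 else ((∑ m ∈ S.filter (fun m => d m ∣ j), d m : ℕ) : ℚ) := by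
    intro j
    rw [map_sum, Finset.sum_filter, Nat.cast_sum]
    have h1 : ∀ m, coeff j ((d m : PowerSeries ℚ) *
        PowerSeries.mk fun j => if j ≠ 0 ∧ d m ∣ j then (1 : ℚ) else 0) =
        d m * if j ≠ 0 ∧ d m ∣ j then (1 : ℚ) else 0 := fun m => by
      rw [← map_natCast (C (R := ℚ)), coeff_C_mul, coeff_mk]
    rw [Finset.sum_congr rfl fun m _ => h1 m]
    split_ifs with hj
    · simp [hj]
    · simp [hj]
  have hIcc : Finset.Icc 1 (k + 1) = Finset.Ico 1 (k + 1 + 1) := by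
    ext j; simp only [Finset.mem_Icc, Finset.mem_Ico]; omega
  rw [Nat.succ_eq_add_one, Nat.cast_add, Nat.cast_one, mul_comm, h, h0 0, if_pos rfl, zero_mul,
    add_zero, hIcc, Finset.sum_Ico_eq_sum_range, Nat.add_sub_cancel]
  refine congrArg Neg.neg (Finset.sum_congr rfl fun j _ => ?_)
  rw [h0, if_neg (Nat.succ_ne_zero j), Nat.add_comm 1 j]

end SignedSubsetSums

/-! ### Counting maximal ideals through homomorphisms to finite fields -/

section ResidueFieldCount

variable {K B : Type*} [Field K] [CommGroup B]

theorem isMaximal_ker_algHom {R L : Type*} [CommRing R] [Algebra K R] [Field L] [Algebra K L]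
    [Finite L] (ψ : R →ₐ[K] L) : (RingHom.ker ψ).IsMaximal := by
  have : Finite (R ⧸ RingHom.ker ψ) :=
    Finite.of_injective _ (RingHom.kerLift_injective (ψ : R →+* L))
  have : (RingHom.ker ψ).IsPrime := RingHom.ker_isPrime (ψ : R →+* L)
  exact Ideal.Quotient.maximal_of_isField _ (Finite.isField_of_domain _)

theorem ker_comp_mkₐ {R L : Type*} [CommRing R] [Algebra K R] [Field L] [Algebra K L]
    (m : MaximalSpectrum R) (f : (R ⧸ m.asIdeal) →ₐ[K] L) :
    RingHom.ker (f.comp (Ideal.Quotient.mkₐ K m.asIdeal)) = m.asIdeal := by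
  let _ := Ideal.Quotient.field m.asIdeal
  ext x
  rw [RingHom.mem_ker, AlgHom.comp_apply, map_eq_zero_iff f f.toRingHom.injective,
    Ideal.Quotient.mkₐ_eq_mk, Ideal.Quotient.eq_zero_iff_mem]

/-- An algebra homomorphism to a finite field consists of a maximal ideal and an embedding of its
residue field. -/
noncomputable def residueAlgHomEquiv {R L : Type*} [CommRing R] [Algebra K R] [Field L]
    [Algebra K L] [Finite L] :
    (Σ m : MaximalSpectrum R, (R ⧸ m.asIdeal) →ₐ[K] L) ≃ (R →ₐ[K] L) := by
  refine Equiv.ofBijective (fun x => x.2.comp (Ideal.Quotient.mkₐ K x.1.asIdeal)) ⟨?_, ?_⟩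
  · rintro ⟨m, f⟩ ⟨m', f'⟩ h
    simp only at h
    obtain rfl : m = m' := by
      apply MaximalSpectrum.ext
      rw [← ker_comp_mkₐ m f, h, ker_comp_mkₐ]
    rw [Ideal.Quotient.algHom_ext K h]
  · intro ψ
    exact ⟨⟨⟨RingHom.ker ψ, isMaximal_ker_algHom ψ⟩, Ideal.Quotient.liftₐ _ ψ fun x hx => hx⟩,
      AlgHom.ext fun x => rfl⟩

/-- Galois theory of finite fields: an extension of degree `d` has `d` embeddings into `L` if `d ∣
[L : K]`, and none otherwise. For an infinite residue field the degree is `0`, which does not divide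
the positive `[L : K]`. -/
theorem natCard_residue_algHom {L : Type*} [Field L] [Algebra K L] [Finite L]
    (m : MaximalSpectrum (MonoidAlgebra K B)) :
    Nat.card ((MonoidAlgebra K B ⧸ m.asIdeal) →ₐ[K] L) =
      if residueDegree m ∣ Module.finrank K L then residueDegree m else 0 := by
  let _ := Ideal.Quotient.field m.asIdeal
  split_ifs with h
  · exact FiniteField.natCard_algHom_of_finrank_dvd h
  · have := not_nonempty_iff.1 (mt FiniteField.nonempty_algHom_iff_finrank_dvd.1 h)
    exact Nat.card_of_isEmpty

/-- Algebra homomorphisms from `K[B]` to a field are homomorphisms from `B` to its unit group. -/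
noncomputable def groupAlgebraHomEquiv (L : Type*) [Field L] [Algebra K L] :
    (MonoidAlgebra K B →ₐ[K] L) ≃ (B →* Lˣ) :=
  (MonoidAlgebra.lift K L B).symm.trans
    { toFun := fun f => f.toHomUnits
      invFun := fun f => (Units.coeHom L).comp f
      left_inv := fun f => by ext; rfl
      right_inv := fun f => by ext; rfl }

/-- Homomorphisms `B → Lˣ` are algebra maps `K[B] → L`. Such a map is a kernel `m`, which is maximal
since `L` is finite, together with one of the `deg m` embeddings of its residue field. -/
theorem natCard_monoidHom_units (S : Finset (MaximalSpectrum (MonoidAlgebra K B)))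
    (hS : ∀ m, m ∈ S → 0 < residueDegree m) (L : Type*) [Field L] [Algebra K L] [Finite L]
    (hS' : ∀ m, 0 < residueDegree m → residueDegree m ≤ Module.finrank K L → m ∈ S) :
    Nat.card (B →* Lˣ) =
      ∑ m ∈ S.filter (fun m => residueDegree m ∣ Module.finrank K L), residueDegree m := by
  classical
  have : Finite K := Finite.of_injective _ (algebraMap K L).injective
  set S' := S.filter (fun m => residueDegree m ∣ Module.finrank K L)
  have e : (Σ m : S', (MonoidAlgebra K B ⧸ m.1.asIdeal) →ₐ[K] L) ≃
      Σ m : MaximalSpectrum (MonoidAlgebra K B), (MonoidAlgebra K B ⧸ m.asIdeal) →ₐ[K] L :=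
    Equiv.ofBijective (fun x => ⟨x.1.1, x.2⟩) ⟨by
      rintro ⟨⟨m, hm⟩, f⟩ ⟨⟨m', hm'⟩, f'⟩ h
      simp only [Sigma.mk.injEq] at h
      obtain ⟨rfl, h⟩ := h
      rw [eq_of_heq h], by
      rintro ⟨m, f⟩
      let _ := Ideal.Quotient.field m.asIdeal
      have hdvd : residueDegree m ∣ Module.finrank K L :=
        FiniteField.nonempty_algHom_iff_finrank_dvd.1 ⟨f⟩
      have hpos : 0 < Module.finrank K L := Module.finrank_pos
      exact ⟨⟨⟨m, Finset.mem_filter.2 ⟨hS' m (Nat.pos_of_dvd_of_pos hdvd hpos)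
        (Nat.le_of_dvd hpos hdvd), hdvd⟩⟩, f⟩, rfl⟩⟩
  have hfin : ∀ m : S', Finite ((MonoidAlgebra K B ⧸ m.1.asIdeal) →ₐ[K] L) := fun m => by
    have hm := Finset.mem_filter.1 m.2
    refine Nat.finite_of_card_ne_zero ?_
    rw [natCard_residue_algHom, if_pos hm.2]
    exact (hS _ hm.1).ne'
  rw [← Nat.card_congr (groupAlgebraHomEquiv (K := K) (B := B) L),
    ← Nat.card_congr residueAlgHomEquiv, ← Nat.card_congr e, Nat.card_sigma,
    ← Finset.sum_coe_sort S']
  refine Finset.sum_congr rfl fun m _ => ?_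
  rw [natCard_residue_algHom, if_pos (Finset.mem_filter.1 m.2).2]

theorem exists_field_finrank_eq (K : Type*) [Field K] [Finite K] {d : ℕ} (hd : 0 < d) :
    ∃ (L : Type) (_ : Field L) (_ : Algebra K L), Finite L ∧ Module.finrank K L = d := by
  obtain ⟨p, hp⟩ := CharP.exists K
  have : Fact p.Prime := ⟨CharP.char_is_prime K p⟩
  have : NeZero d := ⟨hd.ne'⟩
  exact ⟨FiniteField.Extension K p d, inferInstance, inferInstance, inferInstance,
    FiniteField.finrank_extension K p d⟩

/-- An ideal of degree `d > 0` is the kernel of an algebra map to the field of degree `d`, and there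
are finitely many such maps by `hB`. -/
theorem finite_residueDegree_le [Finite K] (hB : ∀ (G : Type) [Group G] [Finite G], Finite (B →* G))
    (N : ℕ) :
    {m : MaximalSpectrum (MonoidAlgebra K B) |
      0 < residueDegree m ∧ residueDegree m ≤ N}.Finite := by
  have key : ∀ d, 0 < d →
      {m : MaximalSpectrum (MonoidAlgebra K B) | residueDegree m = d}.Finite := by
    intro d hd
    obtain ⟨L, _, _, _, hL⟩ := exists_field_finrank_eq K hd
    have := hB Lˣ
    have : Finite (MonoidAlgebra K B →ₐ[K] L) := Finite.of_equiv _ (groupAlgebraHomEquiv L).symm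
    have : Finite (Σ m : MaximalSpectrum (MonoidAlgebra K B),
        (MonoidAlgebra K B ⧸ m.asIdeal) →ₐ[K] L) := Finite.of_equiv _ residueAlgHomEquiv.symm
    refine (Set.finite_range (fun x : (Σ m : MaximalSpectrum (MonoidAlgebra K B),
        (MonoidAlgebra K B ⧸ m.asIdeal) →ₐ[K] L) => x.1)).subset ?_
    intro m hm
    let _ := Ideal.Quotient.field m.asIdeal
    have hdeg : Module.finrank K (MonoidAlgebra K B ⧸ m.asIdeal) ∣ Module.finrank K L := by
      rw [hL, ← show residueDegree m = d from hm]
      exact dvd_rfl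
    exact ⟨⟨m, (FiniteField.nonempty_algHom_of_finrank_dvd hdeg).some⟩, rfl⟩
  refine ((Finset.Icc 1 N).finite_toSet.biUnion fun d hd =>
    key d (Finset.mem_Icc.1 hd).1).subset ?_
  intro m hm
  exact Set.mem_biUnion (Finset.mem_coe.2 (Finset.mem_Icc.2 hm)) rfl

end ResidueFieldCount

/-! ### Homomorphisms from `ℤ^k` and `ℤ_p^k` to a finite abelian group -/

section HomCounts

variable {M H : Type*} [CommGroup H]

theorem natCard_hom_pi [AddCommMonoid M] (k : ℕ) :
    Nat.card (Multiplicative (Fin k → M) →* H) = Nat.card (Multiplicative M →* H) ^ k := by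
  have e : ((Fin k → M) →+ Additive H) ≃ (Fin k → M →+ Additive H) :=
    Equiv.ofBijective (fun X i => X.comp (AddMonoidHom.single (fun _ => M) i))
      ⟨fun X Y h => hom_pi_ext X Y (congrFun h), fun F => by
        refine ⟨∑ i, (F i).comp (Pi.evalAddMonoidHom _ i), ?_⟩
        funext i
        ext x
        simp only [AddMonoidHom.comp_apply, AddMonoidHom.finsetSum_apply,
          AddMonoidHom.single_apply, Pi.evalAddMonoidHom_apply]
        rw [Finset.sum_eq_single i]
        · rw [Pi.single_eq_same]
        · intro j _ hj
          rw [Pi.single_eq_of_ne hj, map_zero]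
        · simp⟩
  rw [Nat.card_congr (MonoidHom.toAdditiveRight (α := Fin k → M) (β := H)), Nat.card_congr e,
    Nat.card_congr (MonoidHom.toAdditiveRight (α := M) (β := H)), Nat.card_pi]
  simp

theorem natCard_hom_int_pi (k : ℕ) :
    Nat.card (Multiplicative (Fin k → ℤ) →* H) = Nat.card H ^ k := by
  rw [natCard_hom_pi, ← Nat.card_congr (zpowersHom H)]

/-- The order of `H` is its `p`-part times a unit of `ℤ_p`. So the `p`-part is a multiple of `|H|`
in `ℤ_p`, and `X` kills it, with no continuity needed. -/
theorem hom_padicInt_pow_eq_one (p : ℕ) [Fact p.Prime] [Finite H] (X : Multiplicative ℤ_[p] →* H) :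
    X (Multiplicative.ofAdd 1) ^ pPart p (Nat.card H) = 1 := by
  obtain ⟨u, hu⟩ := (pow_padicValNat_dvd : p ^ padicValNat p (Nat.card H) ∣ Nat.card H)
  have hup : ¬ p ∣ u := fun ⟨w, hw⟩ => by
    refine pow_succ_padicValNat_not_dvd (p := p) (Nat.card_pos (α := H)).ne' ⟨w, ?_⟩
    conv_lhs => rw [hu, hw]
    ring
  obtain ⟨v, hv⟩ : IsUnit (u : ℤ_[p]) := by
    rw [PadicInt.isUnit_iff, PadicInt.norm_natCast_eq_one_iff]
    exact (Nat.Prime.coprime_iff_not_dvd Fact.out).2 hup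
  have h : (pPart p (Nat.card H)) • (1 : ℤ_[p]) = Nat.card H • ((v⁻¹ : ℤ_[p]ˣ) : ℤ_[p]) := by
    have : (Nat.card H : ℤ_[p]) = (pPart p (Nat.card H) : ℕ) * v := by
      rw [hv, pPart, ← Nat.cast_mul, ← hu]
    rw [nsmul_eq_mul, nsmul_eq_mul, this, mul_one, Units.mul_inv_cancel_right]
  rw [← map_pow, ← ofAdd_nsmul, h, ofAdd_nsmul, map_pow, pow_card_eq_one']

/-- The map factors through the reduction `ℤ_p → ℤ/p^a`. -/
theorem exists_hom_padicInt (p a : ℕ) [Fact p.Prime] {h : H} (hh : h ^ p ^ a = 1) :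
    ∃ X : Multiplicative ℤ_[p] →* H, X (Multiplicative.ofAdd 1) = h := by
  let f : ZMod (p ^ a) →+ Additive H := ZMod.lift (p ^ a)
    ⟨zmultiplesHom (Additive H) (Additive.ofMul h), by
      rw [zmultiplesHom_apply, natCast_zsmul, ← ofMul_pow, hh, ofMul_one]⟩
  refine ⟨AddMonoidHom.toMultiplicativeLeft
    (f.comp (PadicInt.toZModPow a : ℤ_[p] →+* ZMod (p ^ a)).toAddMonoidHom), ?_⟩
  change (f (PadicInt.toZModPow a 1)).toMul = h
  have h1 : (1 : ZMod (p ^ a)) = ((1 : ℤ) : ZMod (p ^ a)) := by simp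
  rw [map_one, h1, ZMod.lift_coe]
  simp

/-- Evaluation at `1` identifies homomorphisms with the elements killed by the `p`-part of `|H|`.
Cyclicity makes their number equal to that `p`-part. -/
theorem natCard_hom_padicInt (p : ℕ) [Fact p.Prime] [Finite H] [IsCyclic H] :
    Nat.card (Multiplicative ℤ_[p] →* H) = pPart p (Nat.card H) := by
  have e : (Multiplicative ℤ_[p] →* H) ≃ (powMonoidHom (pPart p (Nat.card H)) : H →* H).ker :=
    Equiv.ofBijective (fun X => ⟨X (Multiplicative.ofAdd 1), hom_padicInt_pow_eq_one p X⟩)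
      ⟨fun X Y h => MonoidHom.toAdditiveRight.injective
          (hom_padicInt_ext p H _ _ (congrArg (fun x => Additive.ofMul x.1) h)), fun h => by
        obtain ⟨X, hX⟩ := exists_hom_padicInt p _ (show h.1 ^ p ^ _ = 1 from h.2)
        exact ⟨X, Subtype.ext hX⟩⟩
  rw [Nat.card_congr e, IsCyclic.card_powMonoidHom_ker, pPart]
  exact Nat.gcd_eq_right pow_padicValNat_dvd

end HomCounts

/-! ### The recursion -/

section Recursion

/-- The common form of both recursions: `B` enters only through the numbers `N j` of homomorphisms
to the unit group of the extension of degree `j`. -/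
theorem equivariantReducedEulerChar_recursion {K A B : Type*} [Field K] [Finite K] [Group A]
    [CommGroup B] (e : A ≃* Multiplicative ℤ × B)
    [∀ n, Finite (A →* LinearMap.GeneralLinearGroup K (Fin n → K))]
    [∀ n, Finite (B →* LinearMap.GeneralLinearGroup K (Fin n → K))]
    (hB : ∀ (G : Type) [Group G] [Finite G], Finite (B →* G)) (N : ℕ → ℕ)
    (hN : ∀ (L : Type) [Field L] [Algebra K L] [Finite L],
      Nat.card (B →* Lˣ) = N (Module.finrank K L))
    (c : ℕ → ℚ) (hc0 : c 0 = 1)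
    (hc : ∀ n, n ≠ 0 → c n = equivariantReducedEulerChar A
      (LinearMap.GeneralLinearGroup K (Fin n → K)) (properSubspaces K (Fin n → K))) :
    c 0 = 1 ∧ c 1 = -N 1 ∧
      ∀ n : ℕ, 1 ≤ n → c n = -(1 / (n : ℚ)) * ∑ j ∈ Finset.Icc 1 n, (N j : ℚ) * c (n - j) := by
  have hrec : ∀ n : ℕ, 1 ≤ n →
      c n = -(1 / (n : ℚ)) * ∑ j ∈ Finset.Icc 1 n, (N j : ℚ) * c (n - j) := by
    intro n hn
    -- Ideals of degree above `n` do not affect coefficients up to `n`, so this one finite set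
    -- serves for every `c i` with `i ≤ n`.
    set S := (finite_residueDegree_le (K := K) hB n).toFinset with hS
    have hmem : ∀ m, m ∈ S ↔ 0 < residueDegree m ∧ residueDegree m ≤ n := fun m => by
      rw [hS, Set.Finite.mem_toFinset]
      rfl
    have hpos : ∀ m ∈ S, 0 < residueDegree m := fun m hm => ((hmem m).1 hm).1
    have hcS : ∀ i ≤ n, c i = ∑ s ∈ S.powerset.filter
        (fun s => ∑ m ∈ s, residueDegree m = i), (-1 : ℚ) ^ s.card := by
      intro i hi
      rcases Nat.eq_zero_or_pos i with rfl | hi0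
      -- All degrees are positive, so only the empty set has total degree `0`, in agreement with the
      -- convention `c 0 = 1`.
      · rw [hc0, Finset.sum_eq_single ∅]
        · simp
        · intro s hs hs0
          obtain ⟨hsS, hsum⟩ := Finset.mem_filter.1 hs
          obtain ⟨m, hm⟩ := Finset.nonempty_iff_ne_empty.2 hs0
          have h1 := Finset.sum_eq_zero_iff.1 hsum m hm
          have h2 := hpos m (Finset.mem_powerset.1 hsS hm)
          omega
        · simp
      · have : Nonempty (Fin i) := ⟨⟨0, hi0⟩⟩
        have := Fintype.ofFinite (B →* LinearMap.GeneralLinearGroup K (Fin i → K))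
        rw [hc i hi0.ne', equivariantReducedEulerChar_eq_sum e,
          sum_card_centralizer_mul_meanMobius S hpos, Module.finrank_fin_fun]
        intro m hm hm'
        rw [Module.finrank_fin_fun] at hm'
        exact (hmem m).2 ⟨hm, hm'.trans hi⟩
    have hNS : ∀ j ∈ Finset.Icc 1 n,
        N j = ∑ m ∈ S.filter (fun m => residueDegree m ∣ j), residueDegree m := by
      intro j hj
      rw [Finset.mem_Icc] at hj
      obtain ⟨L, _, _, _, hL⟩ := exists_field_finrank_eq K (d := j) hj.1
      have h := natCard_monoidHom_units S hpos L (fun m hm hm' =>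
        (hmem m).2 ⟨hm, (hm'.trans hL.le).trans hj.2⟩)
      rwa [hN L, hL] at h
    have h := mul_sum_signed_subsets S residueDegree hpos n
    rw [← hcS n le_rfl, ← Finset.sum_congr rfl fun j hj => by
      rw [← hNS j hj, ← hcS (n - j) (Nat.sub_le n j)]] at h
    have hn0 : (n : ℚ) ≠ 0 := by exact_mod_cast (Nat.pos_of_ne_zero (by omega)).ne'
    field_simp
    linear_combination h
  refine ⟨hc0, ?_, hrec⟩
  rw [hrec 1 le_rfl]
  simp [hc0]

/-- Splitting off one factor of `ℤ ^ (k + 1)`. -/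
def intPowSuccEquiv (k : ℕ) :
    Multiplicative (Fin (k + 1) → ℤ) ≃* Multiplicative ℤ × Multiplicative (Fin k → ℤ) where
  toFun z := (Multiplicative.ofAdd (z.toAdd 0), Multiplicative.ofAdd (Fin.tail z.toAdd))
  invFun z := Multiplicative.ofAdd (Fin.cons z.1.toAdd z.2.toAdd)
  left_inv z := congrArg Multiplicative.ofAdd (Fin.cons_self_tail z.toAdd)
  right_inv _ := rfl
  map_mul' _ _ := rfl

theorem finite_hom_padicInt_pow (p : ℕ) [Fact p.Prime] (k : ℕ) (G : Type*) [Group G] [Finite G] :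
    Finite (Multiplicative (Fin k → ℤ_[p]) →* G) := by
  let π : Multiplicative (ℤ × (Fin k → ℤ_[p])) →* Multiplicative (Fin k → ℤ_[p]) :=
    AddMonoidHom.toMultiplicative (AddMonoidHom.snd ℤ (Fin k → ℤ_[p]))
  have hπ : Function.Surjective π := fun z => ⟨Multiplicative.ofAdd (0, z.toAdd), rfl⟩
  exact Finite.of_injective (fun X : Multiplicative (Fin k → ℤ_[p]) →* G => X.comp π)
    fun X Y h => (MonoidHom.cancel_right hπ).1 h

end Recursion

theorem mainTheorem12 (K : Type*) [Field K] [Finite K] (q : ℕ) (hq : Nat.card K = q)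
    (r : ℕ) (hr : 1 ≤ r) :
    (chi K r 0 = 1 ∧
      chi K r 1 = -((q : ℚ) - 1) ^ (r - 1) ∧
      ∀ n : ℕ, 1 ≤ n →
        chi K r n =
          -(1 / (n : ℚ)) * ∑ j ∈ Finset.Icc 1 n, ((q : ℚ) ^ j - 1) ^ (r - 1) * chi K r (n - j)) ∧
    ∀ (p : ℕ) [Fact p.Prime],
      chiPrimary p K r 0 = 1 ∧
      chiPrimary p K r 1 = -(pPart p (q - 1) : ℚ) ^ (r - 1) ∧
      ∀ n : ℕ, 1 ≤ n →
        chiPrimary p K r n =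
          -(1 / (n : ℚ)) * ∑ j ∈ Finset.Icc 1 n,
            (pPart p (q ^ j - 1) : ℚ) ^ (r - 1) * chiPrimary p K r (n - j) := by
  obtain ⟨k, rfl⟩ : ∃ k, r = k + 1 := ⟨r - 1, by omega⟩
  have hunits : ∀ (L : Type) [Field L] [Algebra K L] [Finite L],
      Nat.card Lˣ = q ^ Module.finrank K L - 1 := by
    intro L _ _ _
    rw [Nat.card_units, Module.natCard_eq_pow_finrank (K := K), hq]
  -- Makes the natural-number subtraction `q ^ j - 1` agree with the rational one.
  have hq1 : ∀ j, 1 ≤ q ^ j := fun j => Nat.one_le_pow _ _ (hq ▸ Nat.card_pos)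
  rw [Nat.add_sub_cancel]
  constructor
  · have h := equivariantReducedEulerChar_recursion (intPowSuccEquiv k)
      (fun G _ _ => inferInstance) (fun j => (q ^ j - 1) ^ k)
      (fun L _ _ _ => by rw [natCard_hom_int_pi, hunits]) (chi K (k + 1)) (if_pos rfl)
      (fun n hn => if_neg hn)
    have hcast : ∀ j, (((q ^ j - 1) ^ k : ℕ) : ℚ) = ((q : ℚ) ^ j - 1) ^ k := fun j => by
      rw [Nat.cast_pow, Nat.cast_sub (hq1 j), Nat.cast_pow, Nat.cast_one]
    simp only [hcast] at h
    simpa only [pow_one] using h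
  · intro p _
    have : ∀ n, Finite (Multiplicative (Fin k → ℤ_[p]) →*
        LinearMap.GeneralLinearGroup K (Fin n → K)) := fun n => finite_hom_padicInt_pow p k _
    have h := equivariantReducedEulerChar_recursion
      (MulEquiv.prodMultiplicative ℤ (Fin k → ℤ_[p]))
      (fun G _ _ => finite_hom_padicInt_pow p k G) (fun j => pPart p (q ^ j - 1) ^ k)
      (fun L _ _ _ => by rw [natCard_hom_pi, natCard_hom_padicInt, hunits])
      (chiPrimary p K (k + 1)) (if_pos rfl) (fun n hn => if_neg hn)
    simp only [Nat.cast_pow, pow_one] at h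
    exact h
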